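/- Let $k$ be a natural number, $[k]=\{1,\dots,k\}$ (with the discrete topology), and let $\mathcal P([k])$ be the set of probability measures on $[k]$. A $k$-graphon is a symmetric, measurable function $W:[0,1]^2\to\mathcal P([k])$; for $i\in[k]$ write $W_i(x,y)=W(x,y)(\{i\})$, and for $f\in C([k])\cong\mathbb R^k$ write $W_f(x,y)=\int_{[k]} f\,dW(x,y)=\sum_{i=1}^k f(i)\,W_i(x,y)$. A $C([k])$-decorated graph $F$ on $n$ vertices is a labelling of the edges $ij$ of the complete graph on $\{1,\dots,n\}$ by functions $F_{ij}\in C([k])$, and its homomorphism density in a $k$-graphon $W$ is $$t(F,W)=\int_{[0,1]^n}\prod_{1\le i<j\le n}W_{F_{ij}}(x_i,x_j)\,dx_1\cdots dx_n .$$ For $k$-graphons $U$ and $W$ let $$d_{\square_k}(U,W)=\sup_{S,T\subseteq[0,1]}\ \sum_{i=1}^k\left|\int_{S\times T}\bigl(U_i(x,y)-W_i(x,y)\bigr)\,dx\,dy\right|,$$ where the supremum is over all measurable $S,T\subseteq[0,1]$, and let $$\delta_{\square_k}(U,W)=\inf_{\varphi}\,d_{\square_k}(U,W^{\varphi}),\qquad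 W^{\varphi}(x,y)=W(\varphi(x),\varphi(y)),$$ where the infimum is over all measure-preserving transformations $\varphi:[0,1]\to[0,1]$ (not necessarily invertible). **Theorem.** Let $U$ and $W$ be $k$-graphons. If $t(F,U)=t(F,W)$ for every $n$ and every $C([k])$-decorated graph $F$ on $n$ vertices, then $\delta_{\square_k}(U,W)=0$. -/

import Mathlib

open MeasureTheory
open scoped unitInterval

noncomputable section

/-- A `K`-decorated graph with vertex set `Fin n`: a labelling of the edges of the complete graph
on `Fin n` by elements of `K`. -/
def DecoratedGraph (K : Type*) (n : ℕ) : Type _ :=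
  (⊤ : SimpleGraph (Fin n)).edgeSet → K

/-- The label `F_{ij}` of the edge `ij`, for `i < j`. -/
def DecoratedGraph.label {K : Type*} {n : ℕ} (F : DecoratedGraph K n) (i j : Fin n)
    (hij : i < j) : K :=
  F ⟨s(i, j), by simpa using hij.ne⟩

/-- A `K`-decorated graphon: a symmetric measurable function from `[0,1]²` to the Borel probability
measures on `K`. -/
structure DecoratedGraphon (K : Type*) [MeasurableSpace K] where
  toFun : I × I → ProbabilityMeasure K
  measurable_toFun : Measurable toFun
  symm : ∀ x y : I, toFun (x, y) = toFun (y, x)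

namespace DecoratedGraphon

variable {K : Type*} [MeasurableSpace K]

/-- `W_f (x, y) = ∫ f dW(x, y)`. -/
def apply [TopologicalSpace K] (W : DecoratedGraphon K) (f : C(K, ℝ)) (z : I × I) : ℝ :=
  ∫ a, f a ∂(W.toFun z : Measure K)

/-- The homomorphism density
`t(F, W) = ∫ ∏_{i < j} W_{F_{ij}}(x_i, x_j) dx_1 ⋯ dx_n` of a `C(K)`-decorated graph `F` on `n`
vertices into the `K`-graphon `W`. -/
def homDensity [TopologicalSpace K] {n : ℕ} (F : DecoratedGraph C(K, ℝ) n)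
    (W : DecoratedGraphon K) : ℝ :=
  ∫ x : Fin n → I, ∏ p : {p : Fin n × Fin n // p.1 < p.2},
    W.apply (F.label p.1.1 p.1.2 p.2) (x p.1.1, x p.1.2)

/-- Equivalence `U ≅ W`: all homomorphism densities of `C(K)`-decorated graphs agree. -/
def Equivalent [TopologicalSpace K] (U W : DecoratedGraphon K) : Prop :=
  ∀ (n : ℕ) (F : DecoratedGraph C(K, ℝ) n), homDensity F U = homDensity F W

/-- `W^φ (x, y) = W (φ x, φ y)` for a measure-preserving `φ : [0,1] → [0,1]`. -/
def pullback (W : DecoratedGraphon K) (φ : I → I) (hφ : MeasurePreserving φ volume volume) :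
    DecoratedGraphon K where
  toFun z := W.toFun (φ z.1, φ z.2)
  measurable_toFun := W.measurable_toFun.comp
    ((hφ.measurable.comp measurable_fst).prodMk (hφ.measurable.comp measurable_snd))
  symm x y := W.symm (φ x) (φ y)

end DecoratedGraphon

/-- A `k`-graphon is a `K`-graphon for `K` the discrete space with `k` points. -/
abbrev KGraphon (k : ℕ) : Type := DecoratedGraphon (Fin k)

namespace KGraphon

variable {k : ℕ}

/-- The graphon `W_i (x, y) = W(x, y)({i})`, the probability of the colour `i`. -/
def color (W : KGraphon k) (i : Fin k) (z : I × I) : ℝ :=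
  (W.toFun z : Measure (Fin k)).real {i}

/-- `∑_i |∫_{S × T} (U_i - W_i)|`. -/
def cutSum (U W : KGraphon k) (S T : Set I) : ℝ :=
  ∑ i : Fin k, |∫ z in S ×ˢ T, (U.color i z - W.color i z)|

/-- `d_{□_k}(U, W)`: the supremum of `∑_i |∫_{S × T} (U_i - W_i)|` over measurable
`S, T ⊆ [0,1]`. -/
def cutDist (U W : KGraphon k) : ℝ :=
  sSup {r : ℝ | ∃ S T : Set I, MeasurableSet S ∧ MeasurableSet T ∧ r = cutSum U W S T}

/-- The cut distance `δ_{□_k}(U, W)`: the infimum of `d_{□_k}(U, W^φ)` over all measure-preserving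
`φ : [0,1] → [0,1]`. -/
def cutDistance (U W : KGraphon k) : ℝ :=
  sInf {r : ℝ | ∃ (φ : I → I) (hφ : MeasurePreserving φ volume volume),
    r = cutDist U (W.pullback φ hφ)}

end KGraphon

end

/-! Sample n uniform points and colour each edge ab independently with law W(x_a, x_b). The
probability that a given colouring c appears is a homomorphism density of W, so equivalent
k-graphons induce the same law on colourings. It remains to see that a typical colouring determines
W up to a rearrangement of [0,1].

Closeness is measured by the density of four-cycles in the difference of kernels, which dominates
the fourth power of the cut norm (`abs_setIntegral_pow_four_le`). Arrange the vertices of c in the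
order of their sample points and spread them over n equal cells. The resulting step kernel is close
to W on average, for two reasons: the sorted sample stays near the identity of [0,1], so W moves
little in L¹ (`eventually_exists_sampling_bound`), and the randomness of the colours has small
second-order effect (`sum_colouringWeight_mul_boxForm_le`). The minimum of the discrepancy over all
arrangements depends on c alone and has small mean.

As the laws agree, some c has small minimal discrepancy to both U and W. The two optimal
arrangements differ by a permutation of the cells, which an interval exchange φ realises, and the
triangle inequality bounds the cut distance of U and W^φ. -/

noncomputable section

/-! ### Four-cycle density and its control of the cut norm -/

section BoxForm

variable {X Y : Type*} [MeasurableSpace X] [MeasurableSpace Y]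

theorem integrable_of_abs_le {μ : Measure X} [IsFiniteMeasure μ] {f : X → ℝ} (hf : Measurable f)
    (C : ℝ) (h : ∀ x, |f x| ≤ C) : Integrable f μ :=
  Integrable.of_bound hf.aestronglyMeasurable C (ae_of_all _ h)

theorem abs_integral_le_of_abs_le {μ : Measure X} [IsProbabilityMeasure μ] {f : X → ℝ}
    (C : ℝ) (h : ∀ x, |f x| ≤ C) : |∫ x, f x ∂μ| ≤ C := by
  have := norm_integral_le_of_norm_le_const (μ := μ) (f := f) (C := C) (ae_of_all _ h)
  simpa using this

/-- The kernel `(t, t') ↦ ∫ A(s, t) A(s, t') ds`. -/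
def codegree (μ : Measure X) (A : X × X → ℝ) (p : X × X) : ℝ :=
  ∫ s, A (s, p.1) * A (s, p.2) ∂μ

/-- The density of the four-cycle in the kernel `A`. -/
def boxForm (μ : Measure X) (A : X × X → ℝ) : ℝ :=
  ∫ p, codegree μ A p ^ 2 ∂(μ.prod μ)

theorem measurable_codegree (μ : Measure X) [SFinite μ] {A : X × X → ℝ} (hA : Measurable A) :
    Measurable (codegree μ A) := by
  have : Measurable (fun q : X × (X × X) => A (q.1, q.2.1) * A (q.1, q.2.2)) := by fun_prop
  exact (this.stronglyMeasurable.integral_prod_left' (μ := μ)).measurable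

theorem abs_codegree_le_one (μ : Measure X) [IsProbabilityMeasure μ] {A : X × X → ℝ}
    (hA1 : ∀ z, |A z| ≤ 1) (p : X × X) : |codegree μ A p| ≤ 1 := by
  refine abs_integral_le_of_abs_le 1 fun s => ?_
  rw [abs_mul]
  exact mul_le_one₀ (hA1 _) (abs_nonneg _) (hA1 _)

theorem boxForm_nonneg (μ : Measure X) (A : X × X → ℝ) : 0 ≤ boxForm μ A :=
  integral_nonneg fun _ => sq_nonneg _

/-- Two different spaces are needed: the form is transported along φ : [0,1] → [0,1] and also from
[0,1] to the finite vertex set. -/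
theorem boxForm_comp {μ : Measure X} {ν : Measure Y} [SFinite μ] [SFinite ν] {φ : X → Y}
    (hφ : MeasurePreserving φ μ ν) {A : Y × Y → ℝ} (hA : Measurable A) :
    boxForm μ (A ∘ Prod.map φ φ) = boxForm ν A := by
  have h1 : ∀ p, codegree μ (A ∘ Prod.map φ φ) p = codegree ν A (Prod.map φ φ p) := by
    intro p
    unfold codegree
    rw [← hφ.map_eq, integral_map hφ.measurable.aemeasurable]
    · rfl
    · exact Measurable.aestronglyMeasurable (by fun_prop)
  have h2 := hφ.prod hφ
  unfold boxForm
  simp_rw [h1]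
  rw [← h2.map_eq, integral_map h2.measurable.aemeasurable]
  exact ((measurable_codegree ν hA).pow_const 2).aestronglyMeasurable

theorem sq_integral_le {μ : Measure X} [IsProbabilityMeasure μ] {f : X → ℝ} (hf : Measurable f)
    (C : ℝ) (h : ∀ x, |f x| ≤ C) : (∫ x, f x ∂μ) ^ 2 ≤ ∫ x, f x ^ 2 ∂μ := by
  have hi := integrable_of_abs_le (μ := μ) hf C h
  have hi2 : Integrable (fun x => f x ^ 2) μ :=
    integrable_of_abs_le (hf.pow_const 2) (C ^ 2) fun x => by
      rw [abs_pow]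
      exact pow_le_pow_left₀ (abs_nonneg _) (h x) 2
  set c := ∫ x, f x ∂μ with hc
  have h0 : 0 ≤ ∫ x, (f x - c) ^ 2 ∂μ := integral_nonneg fun _ => sq_nonneg _
  have h1 : ∫ x, (f x - c) ^ 2 ∂μ = ∫ x, (f x ^ 2 - 2 * c * f x + c ^ 2) ∂μ :=
    integral_congr_ae (ae_of_all _ fun x => by ring)
  have hi3 : Integrable (fun x => f x ^ 2 - 2 * c * f x) μ := hi2.sub (hi.const_mul _)
  rw [h1, integral_add hi3 (integrable_const _), integral_sub hi2 (hi.const_mul _), integral_const_mul, ← hc] at h0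
  simp at h0
  nlinarith

/-- Cauchy–Schwarz twice: the first application, in s, removes the indicator of S; expanding the
square produces the codegree, and the second, in (t, t'), removes the indicators of T. -/
theorem abs_setIntegral_pow_four_le (μ : Measure X) [IsProbabilityMeasure μ] {A : X × X → ℝ}
    (hA : Measurable A) (hA1 : ∀ z, |A z| ≤ 1) {S T : Set X} (hS : MeasurableSet S)
    (hT : MeasurableSet T) :
    |∫ z in S ×ˢ T, A z ∂(μ.prod μ)| ^ 4 ≤ boxForm μ A := by
  set τ : X → ℝ := T.indicator 1 with hτ
  have hτm : Measurable τ := measurable_one.indicator hT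
  have hτ1 : ∀ t, |τ t| ≤ 1 := fun t => by
    by_cases h : t ∈ T <;> simp [hτ, h]
  set g : X → ℝ := fun s => ∫ t, τ t * A (s, t) ∂μ with hg
  have hgm : Measurable g := by
    have : Measurable (fun q : X × X => τ q.2 * A q) := by fun_prop
    exact (this.stronglyMeasurable.integral_prod_right' (ν := μ)).measurable
  have hg1 : ∀ s, |g s| ≤ 1 := fun s => by
    refine abs_integral_le_of_abs_le 1 fun t => ?_
    rw [abs_mul]
    exact mul_le_one₀ (hτ1 _) (abs_nonneg _) (hA1 _)
  have e1 : ∫ z in S ×ˢ T, A z ∂(μ.prod μ) = ∫ s, S.indicator g s ∂μ := by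
    rw [setIntegral_prod _ (integrable_of_abs_le hA 1 hA1).integrableOn,
      integral_indicator hS]
    refine integral_congr_ae (ae_of_all _ fun s => ?_)
    simp only [hg]
    rw [← integral_indicator hT]
    refine integral_congr_ae (ae_of_all _ fun t => ?_)
    by_cases h : t ∈ T <;> simp [hτ, h]
  have hSg : ∀ s, |S.indicator g s| ≤ 1 := fun s => by
    by_cases h : s ∈ S <;> simp [h, hg1]
  have e2 : (∫ s, S.indicator g s ∂μ) ^ 2 ≤ ∫ s, g s ^ 2 ∂μ := by
    refine (sq_integral_le (hgm.indicator hS) 1 hSg).trans ?_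
    refine integral_mono (integrable_of_abs_le ((hgm.indicator hS).pow_const 2) 1 fun s => ?_)
      (integrable_of_abs_le (hgm.pow_const 2) 1 fun s => ?_) fun s => ?_
    · rw [abs_pow]; exact pow_le_one₀ (abs_nonneg _) (hSg s)
    · rw [abs_pow]; exact pow_le_one₀ (abs_nonneg _) (hg1 s)
    · by_cases h : s ∈ S <;> simp [h, sq_nonneg]
  have e3 : ∫ s, g s ^ 2 ∂μ = ∫ p, τ p.1 * τ p.2 * codegree μ A p ∂(μ.prod μ) := by
    have h1 : ∀ s, g s ^ 2 = ∫ p, (τ p.1 * A (s, p.1)) * (τ p.2 * A (s, p.2)) ∂(μ.prod μ) :=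
      fun s => by
        rw [integral_prod_mul (fun t => τ t * A (s, t)) (fun t => τ t * A (s, t)), sq]
    simp_rw [h1]
    rw [integral_integral_swap]
    · refine integral_congr_ae (ae_of_all _ fun p => ?_)
      simp only [codegree]
      rw [← integral_const_mul]
      exact integral_congr_ae (ae_of_all _ fun s => by ring)
    · refine integrable_of_abs_le (C := 1) ?_ fun q => ?_
      · simp only [Function.uncurry_def]; fun_prop
      · simp only [Function.uncurry_def, abs_mul]
        exact mul_le_one₀ (mul_le_one₀ (hτ1 _) (abs_nonneg _) (hA1 _)) (by positivity)
          (mul_le_one₀ (hτ1 _) (abs_nonneg _) (hA1 _))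
  have hcm := measurable_codegree μ hA
  have hc1 := abs_codegree_le_one μ hA1
  have hb : ∀ p : X × X, |τ p.1 * τ p.2 * codegree μ A p| ≤ |codegree μ A p| := fun p => by
    rw [abs_mul, abs_mul]
    exact mul_le_of_le_one_left (abs_nonneg _) (mul_le_one₀ (hτ1 _) (abs_nonneg _) (hτ1 _))
  have e4 : (∫ s, g s ^ 2 ∂μ) ^ 2 ≤ boxForm μ A := by
    rw [e3]
    have hm : Measurable fun p : X × X => τ p.1 * τ p.2 * codegree μ A p := by fun_prop
    refine (sq_integral_le hm 1 fun p => (hb p).trans (hc1 p)).trans ?_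
    refine integral_mono (integrable_of_abs_le (hm.pow_const 2) 1 fun s => ?_)
      (integrable_of_abs_le (hcm.pow_const 2) 1 fun s => ?_) fun s => ?_
    · rw [abs_pow]; exact pow_le_one₀ (abs_nonneg _) ((hb s).trans (hc1 s))
    · rw [abs_pow]; exact pow_le_one₀ (abs_nonneg _) (hc1 s)
    · exact sq_le_sq.2 (hb s)
  rw [e1]
  calc |∫ s, S.indicator g s ∂μ| ^ 4 = ((∫ s, S.indicator g s ∂μ) ^ 2) ^ 2 := by
        rw [← sq_abs (∫ s, S.indicator g s ∂μ)]; ring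
    _ ≤ (∫ s, g s ^ 2 ∂μ) ^ 2 := pow_le_pow_left₀ (sq_nonneg _) e2 2
    _ ≤ _ := e4

/-- The codegrees at (t, t') differ by at most d(t) + d(t'), where d is the column integral of |A -
B|. Codegrees are bounded by 1, so squaring at most doubles this, and each of d(t), d(t') integrates
to the L¹ distance. -/
theorem boxForm_le_add (μ : Measure X) [IsProbabilityMeasure μ] {A B : X × X → ℝ}
    (hA : Measurable A) (hA1 : ∀ z, |A z| ≤ 1) (hB : Measurable B) (hB1 : ∀ z, |B z| ≤ 1) :
    boxForm μ A ≤ boxForm μ B + 4 * ∫ z, |A z - B z| ∂(μ.prod μ) := by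
  set D : X × X → ℝ := fun z => |A z - B z| with hD
  have hDm : Measurable D := (hA.sub hB).abs
  have hD2 : ∀ z, |D z| ≤ 2 := fun z => by
    simp only [hD, abs_abs]
    have := abs_sub (A z) (B z)
    linarith [hA1 z, hB1 z]
  set d : X → ℝ := fun t => ∫ s, D (s, t) ∂μ with hd
  have hdm : Measurable d := (hDm.stronglyMeasurable.integral_prod_left' (μ := μ)).measurable
  have hd2 : ∀ t, |d t| ≤ 2 := fun t => abs_integral_le_of_abs_le 2 fun s => hD2 _
  have hDi : ∀ t, Integrable (fun s => D (s, t)) μ := fun t =>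
    integrable_of_abs_le (by fun_prop) 2 fun s => hD2 _
  have hcod : ∀ (C : X × X → ℝ), Measurable C → (∀ z, |C z| ≤ 1) → ∀ p : X × X,
      Integrable (fun s => C (s, p.1) * C (s, p.2)) μ := fun C hC hC1 p =>
    integrable_of_abs_le (by fun_prop) 1 fun s => by
      rw [abs_mul]; exact mul_le_one₀ (hC1 _) (abs_nonneg _) (hC1 _)
  have h1 : ∀ p : X × X, |codegree μ A p - codegree μ B p| ≤ d p.1 + d p.2 := fun p => by
    simp only [codegree, hd]
    rw [← integral_sub (hcod A hA hA1 p) (hcod B hB hB1 p), ← integral_add (hDi _) (hDi _)]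
    refine (abs_integral_le_integral_abs).trans ?_
    refine integral_mono ((hcod A hA hA1 p).sub (hcod B hB hB1 p)).abs
      ((hDi _).add (hDi _)) fun s => ?_
    have : A (s, p.1) * A (s, p.2) - B (s, p.1) * B (s, p.2)
        = (A (s, p.1) - B (s, p.1)) * A (s, p.2) + B (s, p.1) * (A (s, p.2) - B (s, p.2)) := by
      ring
    simp only [this]
    refine (abs_add_le _ _).trans (add_le_add ?_ ?_)
    · rw [abs_mul]; exact mul_le_of_le_one_right (abs_nonneg _) (hA1 _)
    · rw [abs_mul]; exact mul_le_of_le_one_left (abs_nonneg _) (hB1 _)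
  have h2 : ∀ p : X × X, codegree μ A p ^ 2 ≤ codegree μ B p ^ 2 + (2 * d p.1 + 2 * d p.2) := by
    intro p
    have ha := abs_codegree_le_one μ hA1 p
    have hb := abs_codegree_le_one μ hB1 p
    have e : codegree μ A p ^ 2 - codegree μ B p ^ 2
        ≤ |codegree μ A p - codegree μ B p| * |codegree μ A p + codegree μ B p| := by
      rw [← abs_mul]; refine le_trans (le_of_eq (by ring)) (le_abs_self _)
    have f : |codegree μ A p + codegree μ B p| ≤ 2 := by
      have := abs_add_le (codegree μ A p) (codegree μ B p); linarith
    have := mul_le_mul_of_nonneg_left f (abs_nonneg (codegree μ A p - codegree μ B p))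
    linarith [h1 p]
  have hdi : Integrable d μ := integrable_of_abs_le hdm 2 hd2
  have hsq : ∀ (C : X × X → ℝ), Measurable C → (∀ z, |C z| ≤ 1) →
      Integrable (fun p => codegree μ C p ^ 2) (μ.prod μ) := fun C hC hC1 =>
    integrable_of_abs_le ((measurable_codegree μ hC).pow_const 2) 1 fun p => by
      rw [abs_pow]; exact pow_le_one₀ (abs_nonneg _) (abs_codegree_le_one μ hC1 p)
  have i1 : Integrable (fun p : X × X => 2 * d p.1) (μ.prod μ) := (hdi.comp_fst μ).const_mul 2
  have i2 : Integrable (fun p : X × X => 2 * d p.2) (μ.prod μ) := (hdi.comp_snd μ).const_mul 2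
  have i3 : Integrable (fun p : X × X => 2 * d p.1 + 2 * d p.2) (μ.prod μ) := i1.add i2
  have h3 := integral_mono (hsq A hA hA1) ((hsq B hB hB1).add i3) h2
  have e : ∫ z, D z ∂(μ.prod μ) = ∫ t, d t ∂μ :=
    integral_prod_symm _ (integrable_of_abs_le hDm 2 hD2)
  have h4 : boxForm μ A ≤ boxForm μ B + (2 * ∫ t, d t ∂μ + 2 * ∫ t, d t ∂μ) := by
    refine h3.trans (le_of_eq ?_)
    simp only [Pi.add_apply]
    rw [integral_add (hsq B hB hB1) i3, integral_add i1 i2, integral_const_mul,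
      integral_const_mul, integral_fun_fst (μ := μ) (ν := μ) d,
      integral_fun_snd (μ := μ) (ν := μ) d]
    simp [boxForm]
  rw [e]; linarith

end BoxForm

/-! ### The uniform measure on the vertices -/

section UniformFin

/-- The uniform probability measure on `Fin n`. -/
def uniformFin (n : ℕ) : Measure (Fin n) := (n : ENNReal)⁻¹ • Measure.count

theorem uniformFin_apply {n : ℕ} (s : Set (Fin n)) :
    uniformFin n s = (n : ENNReal)⁻¹ * Measure.count s := by
  simp [uniformFin]

instance uniformFin.isProbabilityMeasure {n : ℕ} [NeZero n] :
    IsProbabilityMeasure (uniformFin n) where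
  measure_univ := by
    rw [uniformFin_apply, Measure.count_univ, ENat.card_eq_coe_fintype_card, Fintype.card_fin]
    exact ENNReal.inv_mul_cancel (by simp [NeZero.ne n]) (by simp)

theorem integral_uniformFin {n : ℕ} (f : Fin n → ℝ) :
    ∫ a, f a ∂(uniformFin n) = (n : ℝ)⁻¹ * ∑ a, f a := by
  simp [uniformFin, integral_smul_measure, integral_count]

theorem lintegral_uniformFin {n : ℕ} (f : Fin n → ENNReal) :
    ∫⁻ a, f a ∂(uniformFin n) = (n : ENNReal)⁻¹ * ∑ a, f a := by
  simp [uniformFin, lintegral_smul_measure, lintegral_count, tsum_fintype]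

theorem measurePreserving_perm_uniformFin {n : ℕ} (π : Equiv.Perm (Fin n)) :
    MeasurePreserving π (uniformFin n) (uniformFin n) where
  measurable := measurable_of_finite _
  map_eq := by
    refine Measure.ext_of_singleton fun a => ?_
    have : π ⁻¹' {a} = {π.symm a} := by
      ext b
      simp [Equiv.eq_symm_apply]
    rw [Measure.map_apply (measurable_of_finite _) (measurableSet_singleton a), this,
      uniformFin_apply, uniformFin_apply, Measure.count_singleton, Measure.count_singleton]

end UniformFin

/-! ### Cells of [0,1] and interval exchanges -/

section IntervalExchange

variable {n : ℕ} [NeZero n]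

theorem NeZero.cast_pos_real (n : ℕ) [NeZero n] : (0 : ℝ) < n :=
  Nat.cast_pos.2 (NeZero.pos n)

/-- The index of the cell of the partition of `[0,1]` into `n` equal intervals that holds `x`. -/
def cell (n : ℕ) [NeZero n] (x : I) : Fin n :=
  -- The `min` puts the endpoint x = 1, where the floor is n, into the last cell.
  ⟨min ⌊(n : ℝ) * x⌋₊ (n - 1), by have := NeZero.pos n; omega⟩

/-- The relative position of `x` in its cell. -/
def cellOffset (n : ℕ) (x : I) : I :=
  ⟨Int.fract ((n : ℝ) * x), Int.fract_nonneg _, (Int.fract_lt_one _).le⟩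

/-- The point at relative position `t` in the `j`-th cell. -/
def cellPoint (n : ℕ) [NeZero n] (p : Fin n × I) : I :=
  ⟨((p.1 : ℕ) + (p.2 : ℝ)) / n, by
    have h0 := NeZero.cast_pos_real n
    have h1 : ((p.1 : ℕ) : ℝ) + 1 ≤ n := by exact_mod_cast p.1.2
    have h2 := p.2.2.1
    have h3 := p.2.2.2
    constructor
    · positivity
    · rw [div_le_one h0]; linarith⟩

theorem cell_monotone : Monotone (cell n) := fun x y h => by
  refine Fin.mk_le_mk.2 (min_le_min_right _ (Nat.floor_le_floor ?_))
  exact mul_le_mul_of_nonneg_left h (Nat.cast_nonneg n)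

theorem measurable_cell : Measurable (cell n) := by
  refine measurable_to_countable' fun a => ?_
  have : cell n ⁻¹' {a} = {x : I | min ⌊(n : ℝ) * x⌋₊ (n - 1) = a} := by
    ext x
    simp [cell, Fin.ext_iff]
  rw [this]
  have hm : Measurable fun x : I => min ⌊(n : ℝ) * x⌋₊ (n - 1) := by fun_prop
  exact hm (measurableSet_singleton (a : ℕ))

theorem measurable_cellOffset {n : ℕ} : Measurable (cellOffset n) := by
  unfold cellOffset
  exact Measurable.subtype_mk (by fun_prop)

theorem measurable_cellPoint : Measurable (cellPoint n) := by
  refine measurable_from_prod_countable_right fun j => ?_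
  exact Measurable.subtype_mk (by fun_prop)

theorem cell_cellPoint (j : Fin n) {t : I} (ht : (t : ℝ) < 1) : cell n (cellPoint n (j, t)) = j := by
  have h0 := NeZero.cast_pos_real n
  have h : ⌊(n : ℝ) * (cellPoint n (j, t) : I)⌋₊ = j := by
    simp only [cellPoint]
    rw [mul_div_cancel₀ _ h0.ne', Nat.floor_eq_iff (by have := t.2.1; positivity)]
    constructor
    · linarith [t.2.1]
    · linarith
  have := j.2
  simp only [cell, h, Fin.ext_iff]
  omega

theorem cellOffset_cellPoint (j : Fin n) {t : I} (ht : (t : ℝ) < 1) :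
    cellOffset n (cellPoint n (j, t)) = t := by
  have h0 := NeZero.cast_pos_real n
  refine Subtype.ext ?_
  simp only [cellOffset, cellPoint]
  rw [mul_div_cancel₀ _ h0.ne', Int.fract_natCast_add]
  exact Int.fract_eq_self.2 ⟨t.2.1, ht⟩

theorem volume_setOf_coe_le (y : ℝ) :
    volume {t : I | (t : ℝ) ≤ y} = ENNReal.ofReal (max 0 (min y 1)) := by
  rcases lt_or_ge y 0 with h | h
  · have : {t : I | (t : ℝ) ≤ y} = ∅ := by
      ext t
      simpa using h.trans_le t.2.1
    rw [this, measure_empty, max_eq_left ((min_le_left _ _).trans h.le), ENNReal.ofReal_zero]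
  · have : {t : I | (t : ℝ) ≤ y} = Set.Iic ⟨min y 1, le_min h zero_le_one, min_le_right _ _⟩ := by
      ext t
      simpa [← Subtype.coe_le_coe] using fun _ => t.2.2
    rw [this, unitInterval.volume_Iic, max_eq_right (le_min h zero_le_one)]

/-- The summand is the length of [0, y] ∩ [j, j + 1]. -/
theorem sum_clamp_sub (m : ℕ) {y : ℝ} (hy : 0 ≤ y) :
    ∑ j ∈ Finset.range m, max 0 (min (y - j) 1) = min y m := by
  induction m with
  | zero => simp [hy]
  | succ m ih =>
    rw [Finset.sum_range_succ, ih]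
    push_cast
    rcases le_total y m with h | h
    · rw [min_eq_left h, max_eq_left ((min_le_left _ _).trans (sub_nonpos.2 h)), add_zero,
        min_eq_left (by linarith)]
    · rw [min_eq_right h]
      rcases le_total y (m + 1) with h' | h'
      · rw [min_eq_left h', min_eq_left (by linarith), max_eq_right (by linarith)]; ring
      · rw [min_eq_right h', min_eq_right (by linarith), max_eq_right (by linarith)]

theorem measurePreserving_cellPoint :
    MeasurePreserving (cellPoint n) ((uniformFin n).prod volume) volume where
  measurable := measurable_cellPoint
  map_eq := by
    have h0 := NeZero.cast_pos_real n
    have : IsProbabilityMeasure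
        (Measure.map (cellPoint n) ((uniformFin n).prod (volume : Measure I))) :=
      Measure.isProbabilityMeasure_map measurable_cellPoint.aemeasurable
    refine Measure.ext_of_Iic _ _ fun a => ?_
    rw [Measure.map_apply measurable_cellPoint measurableSet_Iic,
      Measure.prod_apply (measurable_cellPoint measurableSet_Iic), lintegral_uniformFin]
    have h1 : ∀ j : Fin n, volume (Prod.mk j ⁻¹' (cellPoint n ⁻¹' Set.Iic a))
        = ENNReal.ofReal (max 0 (min ((n : ℝ) * a - (j : ℕ)) 1)) := fun j => by
      rw [← volume_setOf_coe_le]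
      congr 1
      ext t
      simp only [Set.mem_preimage, Set.mem_Iic, ← Subtype.coe_le_coe, cellPoint, Set.mem_ofPred_eq]
      rw [div_le_iff₀ h0]
      constructor <;> intro h <;> linarith
    simp_rw [h1]
    rw [← ENNReal.ofReal_sum_of_nonneg fun _ _ => le_max_left _ _,
      Fin.sum_univ_eq_sum_range fun j : ℕ => max 0 (min ((n : ℝ) * a - j) 1),
      sum_clamp_sub n (mul_nonneg h0.le a.2.1),
      min_eq_left (mul_le_of_le_one_right h0.le a.2.2), unitInterval.volume_Iic,
      ENNReal.ofReal_mul h0.le, ENNReal.ofReal_natCast, ← mul_assoc,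
      ENNReal.inv_mul_cancel (by simp [NeZero.ne n]) (by simp), one_mul]

/-- Composed after `cellPoint n` this map is the identity off the null set of offset 1, so it undoes
the transport of measure by `cellPoint n`. -/
theorem measurePreserving_cell_cellOffset :
    MeasurePreserving (fun x => (cell n x, cellOffset n x)) volume
      ((uniformFin n).prod volume) where
  measurable := measurable_cell.prodMk measurable_cellOffset
  map_eq := by
    have hm : Measurable fun x => (cell n x, cellOffset n x) :=
      measurable_cell.prodMk measurable_cellOffset
    have hae : (fun x => (cell n x, cellOffset n x)) ∘ cellPoint n
        =ᵐ[(uniformFin n).prod volume] id := by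
      have h1 : ∀ᵐ t : I, t ≠ 1 := by simp [ae_iff]
      have h2 : ∀ᵐ p ∂(uniformFin n).prod (volume : Measure I), p.2 ≠ 1 :=
        Measure.quasiMeasurePreserving_snd.ae h1
      filter_upwards [h2] with p hp
      have ht : (p.2 : ℝ) < 1 := lt_of_le_of_ne p.2.2.2 fun h => hp (Subtype.ext h)
      simp only [Function.comp_apply, id]
      exact Prod.ext (cell_cellPoint p.1 ht) (cellOffset_cellPoint p.1 ht)
    rw [← (measurePreserving_cellPoint (n := n)).map_eq, Measure.map_map hm measurable_cellPoint,
      Measure.map_congr hae, Measure.map_id, (measurePreserving_cellPoint (n := n)).map_eq]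

theorem measurePreserving_cell : MeasurePreserving (cell n) volume (uniformFin n) :=
  measurePreserving_fst.comp measurePreserving_cell_cellOffset

/-- Permute the cells and keep the offsets. The identity holds for every x because an offset from
`cellOffset` is a fractional part, hence below 1. -/
theorem exists_measurePreserving_cell_comp (π : Equiv.Perm (Fin n)) :
    ∃ φ : I → I, MeasurePreserving φ volume volume ∧ ∀ x, cell n (φ x) = π (cell n x) := by
  refine ⟨_, measurePreserving_cellPoint.comp
    (((measurePreserving_perm_uniformFin π).prod (MeasurePreserving.id volume)).comp
      measurePreserving_cell_cellOffset), fun x => ?_⟩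
  exact cell_cellPoint _ (Int.fract_lt_one _)

end IntervalExchange

/-! ### Sorted samples and empirical distribution functions -/

section Sorting

theorem integrable_indicator_one {X : Type*} [MeasurableSpace X] {μ : Measure X}
    [IsFiniteMeasure μ] {s : Set X} (hs : MeasurableSet s) :
    Integrable (s.indicator (1 : X → ℝ)) μ :=
  (integrable_const (1 : ℝ)).indicator hs

theorem abs_sub_eq_integral_indicator (s r : I) :
    |(s : ℝ) - r| = ∫ t, |(Set.Ici s).indicator (1 : I → ℝ) t - (Set.Ici r).indicator 1 t| := by
  wlog h : s ≤ r generalizing s r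
  · rw [abs_sub_comm, this r s (le_of_not_ge h)]
    simp_rw [abs_sub_comm]
  have h1 : ∀ t, |(Set.Ici s).indicator (1 : I → ℝ) t - (Set.Ici r).indicator 1 t|
      = (Set.Ico s r).indicator 1 t := fun t => by
    by_cases h1 : s ≤ t <;> by_cases h2 : r ≤ t
    · simp [h1, h2, not_lt.2 h2]
    · simp [h1, h2, not_le.1 h2]
    · exact absurd (h.trans h2) h1
    · simp [h1, h2]
  simp_rw [h1]
  rw [integral_indicator_one measurableSet_Ico, measureReal_def, unitInterval.volume_Ico,
    ENNReal.toReal_ofReal (sub_nonneg.2 (Subtype.coe_le_coe.2 h)), abs_sub_comm,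
    abs_of_nonneg (sub_nonneg.2 (Subtype.coe_le_coe.2 h))]

/-- Write |s - ξ s| as an integral over thresholds t and swap the integrals. For fixed t
monotonicity gives the integrand one sign in s, so the absolute value moves outside and leaves a
difference of distribution functions. -/
theorem integral_abs_sub_of_monotone {ξ : I → I} (hξ : Monotone ξ) :
    ∫ s : I, |(s : ℝ) - ξ s| = ∫ t : I, |(t : ℝ) - volume.real {s | ξ s ≤ t}| := by
  have hm := hξ.measurable
  set f : I → I → ℝ := fun s t =>
    (Set.Ici s).indicator (1 : I → ℝ) t - (Set.Ici (ξ s)).indicator 1 t with hf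
  have hA : MeasurableSet {q : I × I | q.1 ≤ q.2} := measurableSet_le measurable_fst measurable_snd
  have hB : MeasurableSet {q : I × I | ξ q.1 ≤ q.2} :=
    measurableSet_le (hm.comp measurable_fst) measurable_snd
  have hfm : Measurable (Function.uncurry f) :=
    (measurable_one.indicator hA).sub (measurable_one.indicator hB)
  have hf1 : ∀ s t, |f s t| ≤ 1 := fun s t => by
    by_cases h1 : s ≤ t <;> by_cases h2 : ξ s ≤ t <;> simp [hf, h1, h2]
  have e1 : ∀ s : I, |(s : ℝ) - ξ s| = ∫ t, |f s t| := fun s =>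
    abs_sub_eq_integral_indicator s (ξ s)
  simp_rw [e1]
  rw [integral_integral_swap (integrable_of_abs_le hfm.abs 1 fun q => by
    simpa [Function.uncurry_def] using hf1 q.1 q.2)]
  refine integral_congr_ae (ae_of_all _ fun t => ?_)
  -- Opposite signs at s₁ and s₂ would give s₂ ≤ t < s₁ and ξ s₁ ≤ t < ξ s₂, against monotonicity.
  have hsign : (∀ s, 0 ≤ f s t) ∨ (∀ s, f s t ≤ 0) := by
    by_contra! hcon
    obtain ⟨⟨s₁, h₁⟩, s₂, h₂⟩ := hcon
    have a1 : ξ s₁ ≤ t ∧ t < s₁ := by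
      by_cases u : s₁ ≤ t <;> by_cases v : ξ s₁ ≤ t <;> simp [hf, u, v] at h₁
      · linarith
      · exact ⟨v, not_le.1 u⟩
    have a2 : s₂ ≤ t ∧ t < ξ s₂ := by
      by_cases u : s₂ ≤ t <;> by_cases v : ξ s₂ ≤ t <;> simp [hf, u, v] at h₂
      · exact ⟨u, not_le.1 v⟩
      · linarith
    exact absurd (hξ (a2.1.trans a1.2.le)) (not_le.2 (a1.1.trans_lt a2.2))
  have habs : ∫ s, |f s t| = |∫ s, f s t| := by
    rcases hsign with h | h
    · simp_rw [fun s => abs_of_nonneg (h s)]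
      rw [abs_of_nonneg (integral_nonneg h)]
    · simp_rw [fun s => abs_of_nonpos (h s)]
      rw [integral_neg, abs_of_nonpos (integral_nonpos h)]
  have hint : ∫ s, f s t = t - volume.real {s | ξ s ≤ t} := by
    have i1 : ∀ s, f s t = (Set.Iic t).indicator (1 : I → ℝ) s - {s | ξ s ≤ t}.indicator 1 s :=
      fun s => rfl
    simp_rw [i1]
    have m2 : MeasurableSet {s | ξ s ≤ t} := measurableSet_le hm measurable_const
    rw [integral_sub (integrable_indicator_one measurableSet_Iic) (integrable_indicator_one m2),
      integral_indicator_one measurableSet_Iic, integral_indicator_one m2, measureReal_def volume,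
      unitInterval.volume_Iic, ENNReal.toReal_ofReal t.2.1]
  change ∫ s, |f s t| = _
  rw [habs, hint]

variable {n : ℕ} [NeZero n]

/-- The difference at `t` of the uniform and the empirical distribution functions of `x`. -/
def empiricalError (x : Fin n → I) (t : I) : ℝ :=
  (n : ℝ)⁻¹ * ∑ a, ((t : ℝ) - (Set.Ici (x a)).indicator (1 : I → ℝ) t)

theorem abs_sub_indicator_Ici_le (y t : I) : |(t : ℝ) - (Set.Ici y).indicator (1 : I → ℝ) t| ≤ 1 := by
  have := t.2.1
  have := t.2.2
  by_cases h : y ≤ t <;> simp [h, abs_le] <;> constructor <;> linarith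

theorem measurable_sub_indicator_Ici :
    Measurable fun p : I × I => (p.1 : ℝ) - (Set.Ici p.2).indicator (1 : I → ℝ) p.1 := by
  have hA : MeasurableSet {q : I × I | q.2 ≤ q.1} := measurableSet_le measurable_snd measurable_fst
  have : Measurable (Set.indicator {q : I × I | q.2 ≤ q.1} (1 : I × I → ℝ)) :=
    measurable_one.indicator hA
  exact (measurable_subtype_coe.comp measurable_fst).sub this

theorem abs_empiricalError_le (x : Fin n → I) (t : I) : |empiricalError x t| ≤ 1 := by
  have h0 := NeZero.cast_pos_real n
  rw [empiricalError, abs_mul, abs_of_pos (inv_pos.2 h0), inv_mul_le_iff₀ h0, mul_one]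
  refine (Finset.abs_sum_le_sum_abs _ _).trans
    ((Finset.sum_le_sum fun a _ => abs_sub_indicator_Ici_le (x a) t).trans ?_)
  simp

theorem measurable_empiricalError {n : ℕ} :
    Measurable fun p : I × (Fin n → I) => empiricalError p.2 p.1 := by
  unfold empiricalError
  refine Measurable.const_mul (Finset.measurable_sum _ fun a _ => ?_) _
  exact measurable_sub_indicator_Ici.comp
    (measurable_fst.prodMk ((measurable_pi_apply a).comp measurable_snd))

/-- Sorting makes the step function monotone without changing its law, which is the empirical
measure of x. -/
theorem integral_abs_sub_sort_eq (x : Fin n → I) :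
    ∫ s : I, |(s : ℝ) - x (Tuple.sort x (cell n s))| = ∫ t, |empiricalError x t| := by
  have h0 := NeZero.cast_pos_real n
  rw [integral_abs_sub_of_monotone (ξ := fun s => x (Tuple.sort x (cell n s)))
    ((Tuple.monotone_sort x).comp cell_monotone)]
  refine integral_congr_ae (ae_of_all _ fun t => ?_)
  have hmp := (measurePreserving_perm_uniformFin (Tuple.sort x)).comp (measurePreserving_cell (n := n))
  have e : volume.real {s : I | x (Tuple.sort x (cell n s)) ≤ t}
      = (uniformFin n).real {a | x a ≤ t} :=
    hmp.measureReal_preimage (s := {a | x a ≤ t}) (Set.toFinite _).measurableSet.nullMeasurableSet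
  have e2 : (uniformFin n).real {a | x a ≤ t}
      = (n : ℝ)⁻¹ * ∑ a, (Set.Ici (x a)).indicator (1 : I → ℝ) t := by
    rw [← integral_indicator_one (Set.toFinite _).measurableSet, integral_uniformFin]
    rfl
  simp only [e, e2, empiricalError, Finset.sum_sub_distrib, mul_sub]
  congr 2
  simp [h0.ne']

theorem integral_abs_sub_sort_le (x : Fin n → I) {δ : ℝ} (hδ : 0 < δ) :
    ∫ s : I, |(s : ℝ) - x (Tuple.sort x (cell n s))|
      ≤ δ + δ⁻¹ * ∫ t, empiricalError x t ^ 2 := by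
  have hm : Measurable (empiricalError x) :=
    measurable_empiricalError.comp (measurable_id.prodMk measurable_const)
  have i1 := integrable_of_abs_le (μ := volume) hm 1 (abs_empiricalError_le x)
  have i2 : Integrable (fun t => empiricalError x t ^ 2) volume :=
    integrable_of_abs_le (hm.pow_const 2) 1 fun t => by
      rw [abs_pow]; exact pow_le_one₀ (abs_nonneg _) (abs_empiricalError_le x t)
  rw [integral_abs_sub_sort_eq, ← integral_const_mul]
  have : ∫ t : I, (δ + δ⁻¹ * empiricalError x t ^ 2)
      = δ + ∫ t, δ⁻¹ * empiricalError x t ^ 2 := by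
    rw [integral_add (integrable_const _) (i2.const_mul _)]; simp
  rw [← this]
  refine integral_mono i1.abs ((integrable_const _).add (i2.const_mul _)) fun t => ?_
  simp only
  rw [← sq_abs (empiricalError x t)]
  set u := |empiricalError x t|
  -- Completing the square gives u ≤ δ + u² / δ, which trades the L¹ error for the L² error that has
  -- a computable mean.
  have : δ + δ⁻¹ * u ^ 2 - u = δ⁻¹ * ((u - δ / 2) ^ 2 + 3 / 4 * δ ^ 2) := by
    field_simp; ring
  have h : 0 ≤ δ⁻¹ * ((u - δ / 2) ^ 2 + 3 / 4 * δ ^ 2) := by positivity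
  linarith

theorem measurePreserving_eval_pair {ι : Type*} [Fintype ι] {a b : ι} (hab : a ≠ b) :
    MeasurePreserving (fun x : ι → I => (x a, x b)) volume (volume.prod volume) where
  measurable := by fun_prop
  map_eq := by
    have hi := ProbabilityTheory.iIndepFun_pi (μ := fun _ : ι => (volume : Measure I))
      (X := fun _ => id) fun _ => aemeasurable_id
    have h2 := (ProbabilityTheory.indepFun_iff_map_prod_eq_prod_map_map
      (measurable_pi_apply a).aemeasurable (measurable_pi_apply b).aemeasurable).1 (hi.indepFun hab)
    have ha := (measurePreserving_eval (fun _ : ι => (volume : Measure I)) a).map_eq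
    have hb := (measurePreserving_eval (fun _ : ι => (volume : Measure I)) b).map_eq
    change Measure.map _ (Measure.pi fun _ => volume) = _
    rw [h2]
    exact congrArg₂ _ ha hb

theorem integral_sub_indicator_Ici (t : I) :
    ∫ y : I, ((t : ℝ) - (Set.Ici y).indicator (1 : I → ℝ) t) = 0 := by
  have : ∀ y : I, (Set.Ici y).indicator (1 : I → ℝ) t = (Set.Iic t).indicator 1 y := fun y => rfl
  simp_rw [this]
  rw [integral_sub (integrable_const _) (integrable_indicator_one measurableSet_Iic),
    integral_indicator_one measurableSet_Iic, measureReal_def, unitInterval.volume_Iic,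
    ENNReal.toReal_ofReal t.2.1]
  simp

/-- The summands are independent with mean zero, so only the n diagonal products survive, each at
most 1. -/
theorem integral_sq_empiricalError_le (t : I) :
    ∫ x : Fin n → I, empiricalError x t ^ 2 ≤ (n : ℝ)⁻¹ := by
  have h0 := NeZero.cast_pos_real n
  set h : I → ℝ := fun y => (t : ℝ) - (Set.Ici y).indicator (1 : I → ℝ) t with hh
  have hm : Measurable h :=
    measurable_sub_indicator_Ici.comp (measurable_const.prodMk measurable_id)
  have h1 : ∀ y, |h y| ≤ 1 := fun y => abs_sub_indicator_Ici_le y t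
  have hprod : ∀ y z, |h y * h z| ≤ 1 := fun y z => by
    rw [abs_mul]; exact mul_le_one₀ (h1 _) (abs_nonneg _) (h1 _)
  have e : ∀ x : Fin n → I, empiricalError x t ^ 2
      = (n : ℝ)⁻¹ ^ 2 * ∑ a, ∑ b, h (x a) * h (x b) := fun x => by
    rw [empiricalError, mul_pow, sq (∑ a, _), Finset.sum_mul_sum]
  have hint : ∀ a b : Fin n, Integrable (fun x : Fin n → I => h (x a) * h (x b)) volume :=
    fun a b => integrable_of_abs_le (by fun_prop) 1 fun x => hprod _ _
  simp_rw [e]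
  rw [integral_const_mul, integral_finsetSum _ fun a _ => integrable_finsetSum _ fun b _ => hint a b]
  have hab : ∀ a b : Fin n, ∫ x : Fin n → I, h (x a) * h (x b) ≤ if a = b then 1 else 0 := by
    intro a b
    by_cases hab : a = b
    · rw [if_pos hab]
      exact (le_abs_self _).trans (abs_integral_le_of_abs_le 1 fun x => hprod _ _)
    · rw [if_neg hab]
      have hp := measurePreserving_eval_pair hab
      have e2 : ∫ x : Fin n → I, h (x a) * h (x b)
          = ∫ p, h p.1 * h p.2 ∂((volume : Measure I).prod (volume : Measure I)) := by
        rw [← hp.map_eq, integral_map hp.measurable.aemeasurable]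
        exact Measurable.aestronglyMeasurable (by fun_prop)
      rw [e2, integral_prod_mul, integral_sub_indicator_Ici, zero_mul]
  have hsum : ∑ a : Fin n, ∫ x : Fin n → I, ∑ b, h (x a) * h (x b) ≤ n := by
    calc _ = ∑ a : Fin n, ∑ b, ∫ x : Fin n → I, h (x a) * h (x b) :=
          Finset.sum_congr rfl fun a _ => integral_finsetSum _ fun b _ => hint a b
      _ ≤ ∑ a : Fin n, ∑ b : Fin n, if a = b then 1 else 0 :=
          Finset.sum_le_sum fun a _ => Finset.sum_le_sum fun b _ => hab a b
      _ = n := by simp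
  calc _ ≤ (n : ℝ)⁻¹ ^ 2 * n := mul_le_mul_of_nonneg_left hsum (by positivity)
    _ = _ := by field_simp

theorem integral_integral_sq_empiricalError_le :
    ∫ x : Fin n → I, ∫ t, empiricalError x t ^ 2 ≤ (n : ℝ)⁻¹ := by
  have hm : Measurable fun p : (Fin n → I) × I => empiricalError p.1 p.2 ^ 2 :=
    (measurable_empiricalError.comp measurable_swap).pow_const 2
  have hi : Integrable (fun p : (Fin n → I) × I => empiricalError p.1 p.2 ^ 2)
      (volume.prod volume) := integrable_of_abs_le hm 1 fun p => by
    rw [abs_pow]; exact pow_le_one₀ (abs_nonneg _) (abs_empiricalError_le _ _)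
  rw [integral_integral_swap hi]
  have := integral_mono (hi.integral_prod_right) (integrable_const ((n : ℝ)⁻¹))
    (fun t => integral_sq_empiricalError_le (n := n) t)
  simpa using this

end Sorting

/-! ### Independent random colours on the edges -/

section ProductWeights

variable {E κ : Type*} [Fintype E] [DecidableEq E] [Fintype κ]

/-- The probability of the colouring `c` if the edge `e` gets the colour `i` with probability
`P e i`, independently for all edges. -/
def colouringWeight (P : E → κ → ℝ) (c : E → κ) : ℝ := ∏ e, P e (c e)

theorem sum_colouringWeight {P : E → κ → ℝ} (hP : ∀ e, ∑ i, P e i = 1) :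
    ∑ c, colouringWeight P c = 1 := by
  have := Finset.prod_univ_sum (fun _ : E => (Finset.univ : Finset κ)) P
  simp only [hP, Finset.prod_const_one, Fintype.piFinset_univ] at this
  exact this.symm

/-- Average over the colour of e₀ with all others fixed: R is then constant and the centred
indicator has mean zero. -/
theorem sum_colouringWeight_mul_eq_zero [DecidableEq κ] {P : E → κ → ℝ}
    (hP : ∀ e, ∑ i, P e i = 1) (e₀ : E) (i : κ) {R : (E → κ) → ℝ}
    (hR : ∀ c c' : E → κ, (∀ e, e ≠ e₀ → c e = c' e) → R c = R c') :
    ∑ c, colouringWeight P c * ((P e₀ i - if c e₀ = i then 1 else 0) * R c) = 0 := by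
  rw [← (Equiv.funSplitAt e₀ κ).symm.sum_comp, Fintype.sum_prod_type_right]
  refine Finset.sum_eq_zero fun d _ => ?_
  set Z : ℝ := (∏ e : {e // e ≠ e₀}, P e (d e)) * R ((Equiv.funSplitAt e₀ κ).symm (i, d))
  have h : ∀ j, colouringWeight P ((Equiv.funSplitAt e₀ κ).symm (j, d)) *
      ((P e₀ i - if (Equiv.funSplitAt e₀ κ).symm (j, d) e₀ = i then 1 else 0) *
        R ((Equiv.funSplitAt e₀ κ).symm (j, d)))
      = (P e₀ j * P e₀ i - P e₀ j * if j = i then 1 else 0) * Z := fun j => by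
    have h0 : (Equiv.funSplitAt e₀ κ).symm (j, d) e₀ = j := by simp [Equiv.funSplitAt]
    have h1 : ∀ e : {e // e ≠ e₀}, (Equiv.funSplitAt e₀ κ).symm (j, d) e = d e := fun e => by
      simp [Equiv.funSplitAt, e.2]
    have h2 : R ((Equiv.funSplitAt e₀ κ).symm (j, d)) = R ((Equiv.funSplitAt e₀ κ).symm (i, d)) :=
      hR _ _ fun e he => by simp [Equiv.funSplitAt, he]
    have h3 : colouringWeight P ((Equiv.funSplitAt e₀ κ).symm (j, d))
        = P e₀ j * ∏ e : {e // e ≠ e₀}, P e (d e) := by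
      rw [colouringWeight, Fintype.prod_eq_mul_prod_subtype_ne _ e₀, h0]
      simp_rw [h1]
    rw [h0, h2, h3]
    ring
  simp_rw [h]
  rw [← Finset.sum_mul, Finset.sum_sub_distrib, ← Finset.sum_mul, hP]
  simp

end ProductWeights

/-! ### Four-cycle discrepancy of a random colouring -/

section ColouringMatrix

/-- The edges of the complete graph on `Fin n`. -/
abbrev EdgeIndex (n : ℕ) : Type := {p : Fin n × Fin n // p.1 < p.2}

variable {n : ℕ} {κ : Type*} [DecidableEq κ]

/-- The edge `ab`. -/
def edgeIndex (a b : Fin n) (h : a ≠ b) : EdgeIndex n := ⟨(min a b, max a b), min_lt_max.2 h⟩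

theorem edgeIndex_eq {a b a' b' : Fin n} {h : a ≠ b} {h' : a' ≠ b'}
    (e : edgeIndex a b h = edgeIndex a' b' h') : a = a' ∧ b = b' ∨ a = b' ∧ b = a' := by
  simp only [edgeIndex, Subtype.mk.injEq, Prod.mk.injEq] at e
  obtain ⟨e1, e2⟩ := e
  rcases le_total a b with u | u <;> rcases le_total a' b' with v | v <;>
    simp [u, v] at e1 e2 <;> simp [e1, e2]

/-- The adjacency matrix of the `i`-coloured edges. -/
def colourMatrix (c : EdgeIndex n → κ) (i : κ) (z : Fin n × Fin n) : ℝ :=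
  if h : z.1 ≠ z.2 then if c (edgeIndex z.1 z.2 h) = i then 1 else 0 else 0

theorem colourMatrix_mem_Icc (c : EdgeIndex n → κ) (i : κ) (z : Fin n × Fin n) :
    colourMatrix c i z ∈ Set.Icc (0 : ℝ) 1 := by
  unfold colourMatrix
  split_ifs <;> simp

theorem colourMatrix_congr {c c' : EdgeIndex n → κ} {e₀ : EdgeIndex n}
    (h : ∀ e, e ≠ e₀ → c e = c' e) (i : κ) {a b : Fin n}
    (hab : ∀ hne : a ≠ b, edgeIndex a b hne ≠ e₀) :
    colourMatrix c i (a, b) = colourMatrix c' i (a, b) := by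
  unfold colourMatrix
  split_ifs with h1 h2 h3 h3 <;> simp_all

theorem abs_sub_le_one_of_mem_Icc {u v : ℝ} (hu : u ∈ Set.Icc (0 : ℝ) 1)
    (hv : v ∈ Set.Icc (0 : ℝ) 1) : |u - v| ≤ 1 := by
  rw [abs_le]
  constructor <;> linarith [hu.1, hu.2, hv.1, hv.2]

theorem boxForm_uniformFin (A : Fin n × Fin n → ℝ) :
    boxForm (uniformFin n) A = (n : ℝ)⁻¹ ^ 4 *
      ∑ t, ∑ t', ∑ s, ∑ s', A (s, t) * A (s, t') * (A (s', t) * A (s', t')) := by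
  rcases Nat.eq_zero_or_pos n with rfl | hn
  · simp [boxForm, codegree, uniformFin]
  have : NeZero n := ⟨hn.ne'⟩
  have h : ∀ p, codegree (uniformFin n) A p ^ 2 = (n : ℝ)⁻¹ ^ 2 *
      ∑ s, ∑ s', A (s, p.1) * A (s, p.2) * (A (s', p.1) * A (s', p.2)) := fun p => by
    rw [codegree, integral_uniformFin, mul_pow, sq (∑ s, _), Finset.sum_mul_sum]
  rw [boxForm, integral_prod _ Integrable.of_finite, integral_uniformFin]
  simp_rw [integral_uniformFin, h, ← Finset.mul_sum, ← mul_assoc]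
  congr 1
  ring

/-- Expand over quadruples. If st is an edge distinct from the other three pairs of the cycle, its
centred factor is independent of them and the mean vanishes. The remaining quadruples satisfy one of
four equations, so there are at most 4n³ of them, each contributing at most 1 before the factor n⁻⁴.
-/
theorem sum_colouringWeight_mul_boxForm_le [NeZero n] [Fintype κ] {P : EdgeIndex n → κ → ℝ}
    (hP0 : ∀ e i, 0 ≤ P e i) (hP : ∀ e, ∑ i, P e i = 1) {i : κ} {H : Fin n × Fin n → ℝ}
    (hH : ∀ z, H z ∈ Set.Icc (0 : ℝ) 1)
    (hHP : ∀ a b (hab : a ≠ b), H (a, b) = P (edgeIndex a b hab) i) :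
    ∑ c, colouringWeight P c * boxForm (uniformFin n) (fun z => H z - colourMatrix c i z)
      ≤ 4 * (n : ℝ)⁻¹ := by
  have h0 := NeZero.cast_pos_real n
  have hw0 : ∀ c, 0 ≤ colouringWeight P c := fun c => Finset.prod_nonneg fun e _ => hP0 _ _
  set A : (EdgeIndex n → κ) → Fin n → Fin n → ℝ := fun c a b => H (a, b) - colourMatrix c i (a, b)
    with hA
  have hA1 : ∀ c a b, |A c a b| ≤ 1 := fun c a b =>
    abs_sub_le_one_of_mem_Icc (hH _) (colourMatrix_mem_Icc _ _ _)
  have key : ∀ t t' s s' : Fin n,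
      ∑ c, colouringWeight P c * (A c s t * A c s t' * (A c s' t * A c s' t'))
        ≤ (((if s = t then 1 else 0) + if t = t' then 1 else 0) + if s = s' then 1 else 0)
          + if s = t' then 1 else 0 := by
    intro t t' s s'
    -- These equations are those under which st can be a loop or coincide with st', s't or s't'; the
    -- case s = t' covers the reversed edge s't'. Other coincidences, such as s' = t, are harmless.
    by_cases hdeg : s = t ∨ t = t' ∨ s = s' ∨ s = t'
    · have h1 : ∑ c, colouringWeight P c * (A c s t * A c s t' * (A c s' t * A c s' t')) ≤ 1 := by
        rw [← sum_colouringWeight hP]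
        refine Finset.sum_le_sum fun c _ => mul_le_of_le_one_right (hw0 c) ?_
        refine (le_abs_self _).trans ?_
        rw [abs_mul, abs_mul, abs_mul]
        exact mul_le_one₀ (mul_le_one₀ (hA1 _ _ _) (abs_nonneg _) (hA1 _ _ _)) (by positivity)
          (mul_le_one₀ (hA1 _ _ _) (abs_nonneg _) (hA1 _ _ _))
      refine h1.trans ?_
      split_ifs <;> first | (exfalso; tauto) | norm_num
    · push Not at hdeg
      obtain ⟨d1, d2, d3, d4⟩ := hdeg
      rw [if_neg d1, if_neg d2, if_neg d3, if_neg d4]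
      have hz := sum_colouringWeight_mul_eq_zero hP (edgeIndex s t d1) i
        (R := fun c => A c s t' * (A c s' t * A c s' t')) fun c c' hcc => by
          have e1 : A c s t' = A c' s t' := by
            simp only [hA]
            rw [colourMatrix_congr hcc i fun hne he => ?_]
            rcases edgeIndex_eq he with u | u <;> grind
          have e2 : A c s' t = A c' s' t := by
            simp only [hA]
            rw [colourMatrix_congr hcc i fun hne he => ?_]
            rcases edgeIndex_eq he with u | u <;> grind
          have e3 : A c s' t' = A c' s' t' := by
            simp only [hA]
            rw [colourMatrix_congr hcc i fun hne he => ?_]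
            rcases edgeIndex_eq he with u | u <;> grind
          simp only [e1, e2, e3]
      refine le_of_eq ?_
      rw [add_zero, add_zero, add_zero, ← hz]
      refine Finset.sum_congr rfl fun c _ => ?_
      have : A c s t = P (edgeIndex s t d1) i - if c (edgeIndex s t d1) = i then 1 else 0 := by
        simp only [hA]
        rw [hHP s t d1]
        simp [colourMatrix, d1]
      rw [← this]
      ring
  have hsum : ∑ c, colouringWeight P c * boxForm (uniformFin n) (fun z => H z - colourMatrix c i z)
      = (n : ℝ)⁻¹ ^ 4 * ∑ t, ∑ t', ∑ s, ∑ s',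
        ∑ c, colouringWeight P c * (A c s t * A c s t' * (A c s' t * A c s' t')) := by
    simp_rw [boxForm_uniformFin]
    simp only [Finset.mul_sum]
    rw [Finset.sum_comm]
    refine Finset.sum_congr rfl fun t _ => ?_
    rw [Finset.sum_comm]
    refine Finset.sum_congr rfl fun t' _ => ?_
    rw [Finset.sum_comm]
    refine Finset.sum_congr rfl fun s _ => ?_
    rw [Finset.sum_comm]
    refine Finset.sum_congr rfl fun s' _ => ?_
    refine Finset.sum_congr rfl fun c _ => ?_
    simp only [hA]
    ring
  rw [hsum]
  have hb : ∑ t, ∑ t', ∑ s, ∑ s',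
        ∑ c, colouringWeight P c * (A c s t * A c s t' * (A c s' t * A c s' t')) ≤ 4 * (n : ℝ) ^ 3 := by
    refine (Finset.sum_le_sum fun t _ => Finset.sum_le_sum fun t' _ => Finset.sum_le_sum fun s _ =>
      Finset.sum_le_sum fun s' _ => key t t' s s').trans (le_of_eq ?_)
    simp [Finset.sum_add_distrib]
    ring
  calc _ ≤ (n : ℝ)⁻¹ ^ 4 * (4 * (n : ℝ) ^ 3) := mul_le_mul_of_nonneg_left hb (by positivity)
    _ = _ := by field_simp

end ColouringMatrix

/-! ### L¹ approximation of a kernel by its sorted sample -/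

section Sampling

/-- Continuous functions are dense in L¹, and uniform continuity is recast as an affine modulus:
beyond distance δ the trivial bound 2‖V‖ is absorbed by the slope C = 2‖V‖/δ. An affine modulus can
be integrated against the displacement. -/
theorem exists_continuous_approx {f : I × I → ℝ} (hf : Measurable f)
    (hf1 : ∀ z, f z ∈ Set.Icc (0 : ℝ) 1) {ε : ℝ} (hε : 0 < ε) :
    ∃ (V : I × I → ℝ) (C M : ℝ), Measurable V ∧ 0 ≤ C ∧ 0 ≤ M ∧
      (∫ z, |f z - V z| ≤ ε) ∧ (∀ z, |f z - V z| ≤ M) ∧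
      ∀ p q : I × I, |V p - V q| ≤ ε + C * (|(p.1 : ℝ) - q.1| + |(p.2 : ℝ) - q.2|) := by
  have hfa : ∀ z, |f z| ≤ 1 := fun z => by rw [abs_of_nonneg (hf1 z).1]; exact (hf1 z).2
  obtain ⟨V, hV, -⟩ := (integrable_of_abs_le (μ := (volume : Measure (I × I)))
    hf 1 hfa).exists_boundedContinuous_integral_sub_le hε
  have hVb : ∀ z, |V z| ≤ ‖V‖ := fun z => V.norm_coe_le_norm z
  obtain ⟨δ, hδ, hδV⟩ := Metric.uniformContinuous_iff.1
    (CompactSpace.uniformContinuous_of_continuous V.continuous) ε hε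
  refine ⟨V, 2 * ‖V‖ / δ, 1 + ‖V‖, V.continuous.measurable, by positivity, by positivity, hV,
    fun z => (abs_sub _ _).trans (add_le_add (hfa z) (hVb z)), fun p q => ?_⟩
  have hs : 0 ≤ |(p.1 : ℝ) - q.1| + |(p.2 : ℝ) - q.2| := by positivity
  by_cases h : dist p q < δ
  · have := hδV h
    rw [Real.dist_eq] at this
    have h2 : 0 ≤ 2 * ‖V‖ / δ * (|(p.1 : ℝ) - q.1| + |(p.2 : ℝ) - q.2|) := by positivity
    linarith
  · have h1 : δ ≤ |(p.1 : ℝ) - q.1| + |(p.2 : ℝ) - q.2| := by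
      refine (not_lt.1 h).trans ?_
      rw [Prod.dist_eq]
      exact max_le (le_add_of_nonneg_right (abs_nonneg _)) (le_add_of_nonneg_left (abs_nonneg _))
    have h2 : |V p - V q| ≤ 2 * ‖V‖ := by
      refine (abs_sub _ _).trans ?_
      linarith [hVb p, hVb q]
    have h3 : 2 * ‖V‖ ≤ 2 * ‖V‖ / δ * (|(p.1 : ℝ) - q.1| + |(p.2 : ℝ) - q.2|) := by
      rw [div_mul_eq_mul_div, le_div_iff₀ hδ]
      exact mul_le_mul_of_nonneg_left h1 (by positivity)
    linarith

theorem integral_prod_uniformFin {n : ℕ} [NeZero n] (f : Fin n × Fin n → ℝ) :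
    ∫ p, f p ∂((uniformFin n).prod (uniformFin n)) = (n : ℝ)⁻¹ ^ 2 * ∑ a, ∑ b, f (a, b) := by
  rw [integral_prod _ Integrable.of_finite, integral_uniformFin]
  simp_rw [integral_uniformFin, ← Finset.mul_sum, ← mul_assoc, sq]

variable {n : ℕ} [NeZero n]

/-- The sample point of `x` that the sorted matching assigns to `s`. -/
def sortedSample (x : Fin n → I) (s : I) : I := x (Tuple.sort x (cell n s))

theorem measurable_sortedSample (x : Fin n → I) : Measurable (sortedSample x) :=
  (measurable_of_finite fun a => x (Tuple.sort x a)).comp measurable_cell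

theorem integral_sortedSample (x : Fin n → I) {g : I × I → ℝ} :
    ∫ z : I × I, g (sortedSample x z.1, sortedSample x z.2)
      = (n : ℝ)⁻¹ ^ 2 * ∑ a, ∑ b, g (x a, x b) := by
  have hmp := (measurePreserving_perm_uniformFin (Tuple.sort x)).comp
    (measurePreserving_cell (n := n))
  have hp := hmp.prod hmp
  rw [← integral_prod_uniformFin fun p => g (x p.1, x p.2), ← hp.map_eq,
    integral_map hp.measurable.aemeasurable (measurable_of_finite _).aestronglyMeasurable]
  rfl

/-- Off the diagonal (x_a, x_b) is uniform on the square; the n diagonal terms are only bounded by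
M. -/
theorem integral_mean_le {g : I × I → ℝ} (hg : Measurable g) {M : ℝ} (hgM : ∀ z, |g z| ≤ M) :
    ∫ x : Fin n → I, (n : ℝ)⁻¹ ^ 2 * ∑ a, ∑ b, g (x a, x b)
      ≤ (∫ z, |g z|) + M * (n : ℝ)⁻¹ := by
  have h0 := NeZero.cast_pos_real n
  have hM : 0 ≤ M := (abs_nonneg _).trans (hgM (0, 0))
  have hint : ∀ a b : Fin n, Integrable (fun x : Fin n → I => g (x a, x b)) volume :=
    fun a b => integrable_of_abs_le (by fun_prop) M fun x => hgM _
  have hab : ∀ a b : Fin n, ∫ x : Fin n → I, g (x a, x b)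
      ≤ (∫ z, |g z|) + if a = b then M else 0 := by
    intro a b
    have hn : 0 ≤ ∫ z, |g z| := integral_nonneg fun _ => abs_nonneg _
    by_cases hab : a = b
    · rw [if_pos hab]
      exact ((le_abs_self _).trans (abs_integral_le_of_abs_le M fun x => hgM _)).trans
        (le_add_of_nonneg_left hn)
    · rw [if_neg hab, add_zero]
      have hp := measurePreserving_eval_pair hab
      have e2 : ∫ x : Fin n → I, g (x a, x b) = ∫ z, g z := by
        rw [Measure.volume_eq_prod, ← hp.map_eq, integral_map hp.measurable.aemeasurable
          hg.aestronglyMeasurable]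
      rw [e2]
      exact (le_abs_self _).trans abs_integral_le_integral_abs
  rw [integral_const_mul, integral_finsetSum _ fun a _ => integrable_finsetSum _ fun b _ => hint a b]
  have hsum : ∑ a : Fin n, ∫ x : Fin n → I, ∑ b, g (x a, x b)
      ≤ n ^ 2 * (∫ z, |g z|) + n * M := by
    calc _ = ∑ a : Fin n, ∑ b, ∫ x : Fin n → I, g (x a, x b) :=
          Finset.sum_congr rfl fun a _ => integral_finsetSum _ fun b _ => hint a b
      _ ≤ ∑ a : Fin n, ∑ b : Fin n, ((∫ z, |g z|) + if a = b then M else 0) :=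
          Finset.sum_le_sum fun a _ => Finset.sum_le_sum fun b _ => hab a b
      _ = _ := by simp [Finset.sum_add_distrib]; ring
  calc _ ≤ (n : ℝ)⁻¹ ^ 2 * (n ^ 2 * (∫ z, |g z|) + n * M) :=
        mul_le_mul_of_nonneg_left hsum (by positivity)
    _ = _ := by field_simp

/-- Pass from f to V, move V along the displacement of the sorted sample, and return to f. The
return takes place at sample points, so its cost is a mean over pairs of vertices. -/
theorem integral_abs_sub_sortedSample_le {f V : I × I → ℝ} {C M ε δ : ℝ} (hf : Measurable f)
    (hf1 : ∀ z, f z ∈ Set.Icc (0 : ℝ) 1) (hV : Measurable V) (hC : 0 ≤ C)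
    (hM : ∀ z, |f z - V z| ≤ M) (hfV : ∫ z, |f z - V z| ≤ ε)
    (hVC : ∀ p q : I × I, |V p - V q| ≤ ε + C * (|(p.1 : ℝ) - q.1| + |(p.2 : ℝ) - q.2|))
    (hδ : 0 < δ) (x : Fin n → I) :
    ∫ z : I × I, |f z - f (sortedSample x z.1, sortedSample x z.2)|
      ≤ 2 * ε + 2 * C * (δ + δ⁻¹ * ∫ t, empiricalError x t ^ 2)
        + (n : ℝ)⁻¹ ^ 2 * ∑ a, ∑ b, |f (x a, x b) - V (x a, x b)| := by
  set ξ := sortedSample x with hξ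
  have hξm : Measurable ξ := measurable_sortedSample x
  have hd : Measurable fun z : I × I => |f z - V z| := (hf.sub hV).abs
  have hdi := integrable_of_abs_le (μ := (volume : Measure (I × I))) hd M
    fun z => by rw [abs_abs]; exact hM z
  have hdi' := integrable_of_abs_le (μ := (volume : Measure (I × I)))
    (f := fun z => |f (ξ z.1, ξ z.2) - V (ξ z.1, ξ z.2)|) (by fun_prop) M
    fun z => by rw [abs_abs]; exact hM _
  have hem : Measurable fun s : I => |(s : ℝ) - ξ s| := by fun_prop
  have he1 : ∀ s : I, |(|(s : ℝ) - ξ s|)| ≤ 1 := fun s => by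
    rw [abs_abs]; exact abs_sub_le_one_of_mem_Icc s.2 (ξ s).2
  have hei := integrable_of_abs_le (μ := (volume : Measure I)) hem 1 he1
  have i1 : Integrable (fun z : I × I => |(z.1 : ℝ) - ξ z.1|) volume := hei.comp_fst volume
  have i2 : Integrable (fun z : I × I => |(z.2 : ℝ) - ξ z.2|) volume := hei.comp_snd volume
  have i12 : Integrable (fun z : I × I => |(z.1 : ℝ) - ξ z.1| + |(z.2 : ℝ) - ξ z.2|) volume :=
    i1.add i2
  have i3 : Integrable (fun z : I × I => ε + C * (|(z.1 : ℝ) - ξ z.1| + |(z.2 : ℝ) - ξ z.2|))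
      volume := (integrable_const ε).add (i12.const_mul C)
  have i4 : Integrable (fun z : I × I => |f z - V z|
      + (ε + C * (|(z.1 : ℝ) - ξ z.1| + |(z.2 : ℝ) - ξ z.2|))) volume := hdi.add i3
  have hle : ∀ z : I × I, |f z - f (ξ z.1, ξ z.2)| ≤ |f z - V z|
      + (ε + C * (|(z.1 : ℝ) - ξ z.1| + |(z.2 : ℝ) - ξ z.2|))
      + |f (ξ z.1, ξ z.2) - V (ξ z.1, ξ z.2)| := fun z => by
    have h1 := hVC z (ξ z.1, ξ z.2)
    have h2 : f z - f (ξ z.1, ξ z.2) = (f z - V z) + (V z - V (ξ z.1, ξ z.2))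
      - (f (ξ z.1, ξ z.2) - V (ξ z.1, ξ z.2)) := by ring
    rw [h2]
    have h3 := abs_sub ((f z - V z) + (V z - V (ξ z.1, ξ z.2)))
      (f (ξ z.1, ξ z.2) - V (ξ z.1, ξ z.2))
    have h4 := abs_add_le (f z - V z) (V z - V (ξ z.1, ξ z.2))
    linarith
  have hfi : Integrable (fun z : I × I => |f z - f (ξ z.1, ξ z.2)|) volume :=
    integrable_of_abs_le (by fun_prop) 1 fun z => by
      rw [abs_abs]; exact abs_sub_le_one_of_mem_Icc (hf1 _) (hf1 _)
  have hmono := integral_mono hfi (i4.add hdi') hle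
  have e1 : ∫ z : I × I, |(z.1 : ℝ) - ξ z.1| = ∫ s : I, |(s : ℝ) - ξ s| := by
    rw [Measure.volume_eq_prod]
    have := integral_fun_fst (μ := (volume : Measure I)) (ν := (volume : Measure I))
      (fun s : I => |(s : ℝ) - ξ s|)
    simpa using this
  have e2 : ∫ z : I × I, |(z.2 : ℝ) - ξ z.2| = ∫ s : I, |(s : ℝ) - ξ s| := by
    rw [Measure.volume_eq_prod]
    have := integral_fun_snd (μ := (volume : Measure I)) (ν := (volume : Measure I))
      (fun s : I => |(s : ℝ) - ξ s|)
    simpa using this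
  have e3 : ∫ z : I × I, (|f z - V z| + (ε + C * (|(z.1 : ℝ) - ξ z.1| + |(z.2 : ℝ) - ξ z.2|))
      + |f (ξ z.1, ξ z.2) - V (ξ z.1, ξ z.2)|)
      = (∫ z, |f z - V z|) + (ε + C * ((∫ s : I, |(s : ℝ) - ξ s|) + ∫ s : I, |(s : ℝ) - ξ s|))
        + ∫ z : I × I, |f (ξ z.1, ξ z.2) - V (ξ z.1, ξ z.2)| := by
    rw [integral_add i4 hdi', integral_add hdi i3,
      integral_add (integrable_const ε) (i12.const_mul C), integral_const_mul,
      integral_add i1 i2, e1, e2]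
    simp
  have e4 := integral_sortedSample x (g := fun z => |f z - V z|)
  have e5 : ∫ s : I, |(s : ℝ) - ξ s| ≤ _ := integral_abs_sub_sort_le x hδ
  have e6 := mul_le_mul_of_nonneg_left e5 hC
  refine hmono.trans (e3.le.trans ?_)
  rw [← e4]
  linarith

/-- An integrable majorant B spares any discussion of measurability in x of the left side, which
involves the sorting permutation. -/
theorem eventually_exists_sampling_bound {f : I × I → ℝ} (hf : Measurable f)
    (hf1 : ∀ z, f z ∈ Set.Icc (0 : ℝ) 1) {ε : ℝ} (hε : 0 < ε) :
    ∀ᶠ n : ℕ in Filter.atTop, ∀ [NeZero n], ∃ B : (Fin n → I) → ℝ, Integrable B ∧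
      ∫ x, B x ≤ ε ∧
      ∀ x, ∫ z : I × I, |f z - f (sortedSample x z.1, sortedSample x z.2)| ≤ B x := by
  obtain ⟨V, C, M, hV, hC, hM0, hfV, hM, hVC⟩ :=
    exists_continuous_approx hf hf1 (show 0 < ε / 6 by positivity)
  -- Chosen for 2Cδ ≤ ε/6; the added 1 covers C = 0. The terms with a factor 1/n are made small
  -- afterwards.
  set δ : ℝ := ε / (6 * (2 * C + 1)) with hδ'
  have hδ : 0 < δ := by positivity
  have hCδ : 2 * C * δ ≤ ε / 6 := by
    rw [hδ', mul_div_assoc', div_le_iff₀ (by positivity)]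
    nlinarith
  have hlim : Filter.Tendsto (fun n : ℕ => (2 * C * δ⁻¹ + M) * (n : ℝ)⁻¹) Filter.atTop
      (nhds ((2 * C * δ⁻¹ + M) * 0)) := tendsto_inv_atTop_nhds_zero_nat.const_mul _
  rw [mul_zero] at hlim
  filter_upwards [hlim.eventually (gt_mem_nhds (show 0 < ε / 6 by positivity))] with n hn
  intro _
  have hdm : Measurable fun z : I × I => |f z - V z| := (hf.sub hV).abs
  have hd1 : ∀ z, |(|f z - V z|)| ≤ M := fun z => by rw [abs_abs]; exact hM z
  have hem : Measurable fun p : (Fin n → I) × I => empiricalError p.1 p.2 ^ 2 :=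
    (measurable_empiricalError.comp measurable_swap).pow_const 2
  have j1 : Integrable (fun x : Fin n → I => ∫ t, empiricalError x t ^ 2) volume := by
    refine integrable_of_abs_le
      (hem.stronglyMeasurable.integral_prod_right' (ν := volume)).measurable 1 fun x => ?_
    refine abs_integral_le_of_abs_le 1 fun t => ?_
    rw [abs_pow]; exact pow_le_one₀ (abs_nonneg _) (abs_empiricalError_le _ _)
  have j2 : Integrable (fun x : Fin n → I => (n : ℝ)⁻¹ ^ 2 * ∑ a, ∑ b,
      |f (x a, x b) - V (x a, x b)|) volume :=
    (integrable_finsetSum _ fun a _ => integrable_finsetSum _ fun b _ =>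
      integrable_of_abs_le (by fun_prop) M fun x => hd1 _).const_mul _
  have j4 : Integrable (fun x : Fin n → I => δ + δ⁻¹ * ∫ t, empiricalError x t ^ 2) volume :=
    (integrable_const _).add (j1.const_mul _)
  have j3 : Integrable (fun x : Fin n → I => 2 * (ε / 6)
      + 2 * C * (δ + δ⁻¹ * ∫ t, empiricalError x t ^ 2)) volume :=
    (integrable_const _).add (j4.const_mul _)
  refine ⟨_, j3.add j2, ?_, fun x =>
    integral_abs_sub_sortedSample_le hf hf1 hV hC hM hfV hVC hδ x⟩
  have k1 := integral_integral_sq_empiricalError_le (n := n)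
  have k2 := integral_mean_le (n := n) hdm hd1
  simp only [abs_abs] at k2
  have k3 : ∫ x : Fin n → I, (2 * (ε / 6) + 2 * C * (δ + δ⁻¹ * ∫ t, empiricalError x t ^ 2))
      = 2 * (ε / 6) + 2 * C * (δ + δ⁻¹ * ∫ x : Fin n → I, ∫ t, empiricalError x t ^ 2) := by
    rw [integral_add (integrable_const _) (j4.const_mul _), integral_const_mul (2 * C),
      integral_add (integrable_const _) (j1.const_mul _), integral_const_mul δ⁻¹]
    simp
  simp only [Pi.add_apply]
  rw [integral_add j3 j2, k3]
  have k4 := mul_le_mul_of_nonneg_left k1 (show 0 ≤ 2 * C * δ⁻¹ by positivity)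
  linarith

end Sampling

/-! ### Random colourings drawn from a k-graphon -/

namespace KGraphon

variable {k n : ℕ}

theorem measurable_color (W : KGraphon k) (i : Fin k) : Measurable (W.color i) := by
  have h : Measurable fun z => (W.toFun z : Measure (Fin k)) {i} :=
    (Measure.measurable_coe (measurableSet_singleton i)).comp
      (measurable_subtype_coe.comp W.measurable_toFun)
  exact h.ennreal_toReal

theorem color_mem_Icc (W : KGraphon k) (i : Fin k) (z : I × I) :
    W.color i z ∈ Set.Icc (0 : ℝ) 1 :=
  ⟨measureReal_nonneg, measureReal_le_one⟩

theorem color_symm (W : KGraphon k) (i : Fin k) (x y : I) :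
    W.color i (x, y) = W.color i (y, x) := by
  rw [color, color, W.symm]

theorem sum_color (W : KGraphon k) (z : I × I) : ∑ i, W.color i z = 1 := by
  have h := sum_measureReal_singleton (μ := (W.toFun z : Measure (Fin k))) Finset.univ
  simpa [color] using h

/-- The probabilities of the colours of the edges between the sample points `x`. -/
def edgeProb (W : KGraphon k) (x : Fin n → I) (e : EdgeIndex n) (i : Fin k) : ℝ :=
  W.color i (x e.1.1, x e.1.2)

/-- The indicator function of the colour `i`. -/
def colourIndicator (i : Fin k) : C(Fin k, ℝ) :=
  ⟨Set.indicator {i} 1, continuous_of_discreteTopology⟩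

theorem apply_colourIndicator (W : KGraphon k) (i : Fin k) (z : I × I) :
    W.apply (colourIndicator i) z = W.color i z :=
  integral_indicator_one (measurableSet_singleton i)

/-- The decorated graph of the colouring `c`. -/
def colouringGraph (c : EdgeIndex n → Fin k) : DecoratedGraph C(Fin k, ℝ) n :=
  -- The default 0 is never used: each edge has a representation with increasing endpoints.
  Function.extend (γ := C(Fin k, ℝ)) (fun p : EdgeIndex n =>
    (⟨s(p.1.1, p.1.2), by simpa using p.2.ne⟩ : (⊤ : SimpleGraph (Fin n)).edgeSet))
    (fun p => colourIndicator (c p)) (fun _ => 0)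

theorem colouringGraph_label (c : EdgeIndex n → Fin k) (p : EdgeIndex n) :
    (colouringGraph c).label p.1.1 p.1.2 p.2 = colourIndicator (c p) := by
  refine Function.Injective.extend_apply (fun p q h => ?_) (fun p => colourIndicator (c p))
    (fun _ => 0) p
  have h1 := Subtype.mk.inj h
  rcases Sym2.eq_iff.1 h1 with ⟨h2, h3⟩ | ⟨h2, h3⟩
  · exact Subtype.ext (Prod.ext h2 h3)
  · have := p.2
    have := q.2
    rw [h2, h3] at *
    exact absurd q.2 (by grind)

/-- This density is the probability that the random colouring drawn from W equals c; it is the only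
link to the equivalence hypothesis. -/
theorem homDensity_colouringGraph (W : KGraphon k) (c : EdgeIndex n → Fin k) :
    DecoratedGraphon.homDensity (colouringGraph c) W
      = ∫ x : Fin n → I, colouringWeight (W.edgeProb x) c := by
  unfold DecoratedGraphon.homDensity colouringWeight
  simp_rw [colouringGraph_label, apply_colourIndicator]
  rfl

theorem colouringWeight_edgeProb_nonneg (W : KGraphon k) (x : Fin n → I)
    (c : EdgeIndex n → Fin k) : 0 ≤ colouringWeight (W.edgeProb x) c :=
  Finset.prod_nonneg fun _ _ => (W.color_mem_Icc _ _).1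

theorem integrable_colouringWeight (W : KGraphon k) (c : EdgeIndex n → Fin k) :
    Integrable (fun x : Fin n → I => colouringWeight (W.edgeProb x) c) volume := by
  refine integrable_of_abs_le ?_ 1 fun x => ?_
  · unfold colouringWeight edgeProb
    refine Finset.measurable_prod _ fun e _ => (W.measurable_color _).comp ?_
    exact (measurable_pi_apply _).prodMk (measurable_pi_apply _)
  · rw [abs_of_nonneg (W.colouringWeight_edgeProb_nonneg x c)]
    exact Finset.prod_le_one (fun _ _ => (W.color_mem_Icc _ _).1)
      fun _ _ => (W.color_mem_Icc _ _).2

theorem homDensity_colouringGraph_nonneg (W : KGraphon k) (c : EdgeIndex n → Fin k) :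
    0 ≤ DecoratedGraphon.homDensity (colouringGraph c) W := by
  rw [homDensity_colouringGraph]
  exact integral_nonneg fun x => W.colouringWeight_edgeProb_nonneg x c

theorem sum_homDensity_colouringGraph (W : KGraphon k) :
    ∑ c : EdgeIndex n → Fin k, DecoratedGraphon.homDensity (colouringGraph c) W = 1 := by
  simp_rw [homDensity_colouringGraph]
  rw [← integral_finsetSum _ fun c _ => W.integrable_colouringWeight c]
  simp_rw [fun x : Fin n → I => sum_colouringWeight (P := W.edgeProb x) fun e => W.sum_color _]
  simp

variable [NeZero n]

/-- The kernel of the colour class `i` of `c`, with the vertices arranged by `π`. -/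
def colouringKernel (c : EdgeIndex n → Fin k) (π : Equiv.Perm (Fin n)) (i : Fin k) (z : I × I) : ℝ :=
  colourMatrix c i (π (cell n z.1), π (cell n z.2))

theorem measurable_colouringKernel (c : EdgeIndex n → Fin k) (π : Equiv.Perm (Fin n)) (i : Fin k) :
    Measurable (colouringKernel c π i) :=
  (measurable_of_finite fun p : Fin n × Fin n => colourMatrix c i (π p.1, π p.2)).comp
    ((measurable_cell.comp measurable_fst).prodMk (measurable_cell.comp measurable_snd))

/-- The four-cycle discrepancy of `W` and the colouring `c` with the vertices arranged by `π`. -/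
def discrepancy (W : KGraphon k) (c : EdgeIndex n → Fin k) (π : Equiv.Perm (Fin n)) : ℝ :=
  ∑ i, boxForm volume fun z => W.color i z - colouringKernel c π i z

/-- The least four-cycle discrepancy of `W` and an arrangement of the colouring `c`. -/
def minDiscrepancy (W : KGraphon k) (c : EdgeIndex n → Fin k) : ℝ :=
  Finset.univ.inf' Finset.univ_nonempty (W.discrepancy c)

theorem minDiscrepancy_nonneg (W : KGraphon k) (c : EdgeIndex n → Fin k) :
    0 ≤ W.minDiscrepancy c :=
  Finset.le_inf' _ _ fun _ _ => Finset.sum_nonneg fun _ _ => boxForm_nonneg _ _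

/-- The sorting permutation of x is a candidate for the minimum. Replacing W by its values at the
sorted sample costs the L¹ term; what is left is constant on cells and descends to the vertex set.
-/
theorem minDiscrepancy_le (W : KGraphon k) (c : EdgeIndex n → Fin k) (x : Fin n → I) :
    W.minDiscrepancy c ≤ ∑ i, (boxForm (uniformFin n)
        (fun z => W.color i (x z.1, x z.2) - colourMatrix c i z)
      + 4 * ∫ z : I × I, |W.color i z - W.color i (sortedSample x z.1, sortedSample x z.2)|) := by
  refine (Finset.inf'_le _ (Finset.mem_univ (Tuple.sort x))).trans
    (Finset.sum_le_sum fun i _ => ?_)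
  have hξ := measurable_sortedSample x
  have hW := W.measurable_color i
  have hK := measurable_colouringKernel c (Tuple.sort x) i
  have h := boxForm_le_add (volume : Measure I)
    (A := fun z => W.color i z - colouringKernel c (Tuple.sort x) i z)
    (B := fun z => W.color i (sortedSample x z.1, sortedSample x z.2)
      - colouringKernel c (Tuple.sort x) i z)
    (by fun_prop)
    (fun z => abs_sub_le_one_of_mem_Icc (W.color_mem_Icc _ _) (colourMatrix_mem_Icc _ _ _))
    (by fun_prop)
    (fun z => abs_sub_le_one_of_mem_Icc (W.color_mem_Icc _ _) (colourMatrix_mem_Icc _ _ _))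
  have hmp := (measurePreserving_perm_uniformFin (Tuple.sort x)).comp
    (measurePreserving_cell (n := n))
  have h2 := boxForm_comp hmp (A := fun z => W.color i (x z.1, x z.2) - colourMatrix c i z)
    (measurable_of_finite _)
  refine h.trans (add_le_add (le_of_eq h2) (le_of_eq ?_))
  simp only [sub_sub_sub_cancel_right]
  rfl

theorem sum_colouringWeight_mul_minDiscrepancy_le (W : KGraphon k) (x : Fin n → I) {B : Fin k → ℝ}
    (hB : ∀ i, ∫ z : I × I, |W.color i z - W.color i (sortedSample x z.1, sortedSample x z.2)|
      ≤ B i) :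
    ∑ c, colouringWeight (W.edgeProb x) c * W.minDiscrepancy c
      ≤ ∑ i, (4 * (n : ℝ)⁻¹ + 4 * B i) := by
  have hP : ∀ e : EdgeIndex n, ∑ i, W.edgeProb x e i = 1 := fun e => W.sum_color _
  calc _ ≤ ∑ c, colouringWeight (W.edgeProb x) c * ∑ i, (boxForm (uniformFin n)
        (fun z => W.color i (x z.1, x z.2) - colourMatrix c i z) + 4 * B i) := by
        refine Finset.sum_le_sum fun c _ => mul_le_mul_of_nonneg_left ?_
          (W.colouringWeight_edgeProb_nonneg x c)
        refine (W.minDiscrepancy_le c x).trans (Finset.sum_le_sum fun i _ => ?_)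
        linarith [hB i]
    _ = ∑ i, ((∑ c, colouringWeight (W.edgeProb x) c * boxForm (uniformFin n)
        (fun z => W.color i (x z.1, x z.2) - colourMatrix c i z)) + 4 * B i) := by
        simp_rw [Finset.mul_sum]
        rw [Finset.sum_comm]
        refine Finset.sum_congr rfl fun i _ => ?_
        simp_rw [mul_add]
        rw [Finset.sum_add_distrib, ← Finset.sum_mul, sum_colouringWeight hP, one_mul]
    _ ≤ _ := by
        refine Finset.sum_le_sum fun i _ => add_le_add ?_ le_rfl
        refine sum_colouringWeight_mul_boxForm_le (fun e j => (W.color_mem_Icc _ _).1) hP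
          (H := fun z => W.color i (x z.1, x z.2)) (fun z => W.color_mem_Icc _ _) fun a b hab => ?_
        rcases le_total a b with u | u
        · simp [edgeIndex, u]
        · simp [edgeIndex, u, W.color_symm i (x a) (x b)]

theorem eventually_sum_homDensity_mul_minDiscrepancy_le (W : KGraphon k) {ε : ℝ} (hε : 0 < ε) :
    ∀ᶠ n : ℕ in Filter.atTop, ∀ [NeZero n], ∑ c : EdgeIndex n → Fin k,
      DecoratedGraphon.homDensity (colouringGraph c) W * W.minDiscrepancy c ≤ ε := by
  -- Each colour contributes at most 4η from 1/n and 4η from the sampling bound, so the total is at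
  -- most 8kη ≤ ε.
  set η : ℝ := ε / (8 * (k + 1)) with hη'
  have hη : 0 < η := by positivity
  have h1 := Filter.eventually_all.2 fun i : Fin k =>
    eventually_exists_sampling_bound (W.measurable_color i) (W.color_mem_Icc i) hη
  have h2 := (tendsto_inv_atTop_nhds_zero_nat (𝕜 := ℝ)).eventually (gt_mem_nhds hη)
  filter_upwards [h1, h2] with n hn1 hn2
  intro _
  choose B hBi hBε hB using fun i => hn1 i
  have e1 : ∑ c : EdgeIndex n → Fin k,
      DecoratedGraphon.homDensity (colouringGraph c) W * W.minDiscrepancy c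
      = ∫ x : Fin n → I, ∑ c, colouringWeight (W.edgeProb x) c * W.minDiscrepancy c := by
    rw [integral_finsetSum _ fun c _ => (W.integrable_colouringWeight c).mul_const _]
    refine Finset.sum_congr rfl fun c _ => ?_
    rw [integral_mul_const, homDensity_colouringGraph]
  have i1 : ∀ i, Integrable (fun x => 4 * (n : ℝ)⁻¹ + 4 * B i x) volume := fun i =>
    (integrable_const _).add ((hBi i).const_mul _)
  rw [e1]
  calc _ ≤ ∫ x : Fin n → I, ∑ i, (4 * (n : ℝ)⁻¹ + 4 * B i x) :=
        integral_mono (integrable_finsetSum _ fun c _ =>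
          (W.integrable_colouringWeight c).mul_const _) (integrable_finsetSum _ fun i _ => i1 i)
          fun x => W.sum_colouringWeight_mul_minDiscrepancy_le x fun i => hB i x
    _ = ∑ i, (4 * (n : ℝ)⁻¹ + 4 * ∫ x, B i x) := by
        rw [integral_finsetSum _ fun i _ => i1 i]
        refine Finset.sum_congr rfl fun i _ => ?_
        rw [integral_add (integrable_const _) ((hBi i).const_mul _), integral_const_mul 4 (B i)]
        simp
    _ ≤ ∑ _i : Fin k, 8 * η := Finset.sum_le_sum fun i _ => by linarith [hBε i]
    _ = k * (8 * η) := by simp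
    _ ≤ ε := by
        rw [hη', ← mul_assoc, mul_div_assoc', div_le_iff₀ (by positivity)]
        nlinarith

theorem abs_setIntegral_sub_le {f g h : I × I → ℝ} (hf : Measurable f) (hg : Measurable g)
    (hh : Measurable h) (hf1 : ∀ z, f z ∈ Set.Icc (0 : ℝ) 1) (hg1 : ∀ z, g z ∈ Set.Icc (0 : ℝ) 1)
    (hh1 : ∀ z, h z ∈ Set.Icc (0 : ℝ) 1) {r : ℝ} (hr : 0 ≤ r)
    (hfh : boxForm volume (fun z => f z - h z) ≤ r ^ 4)
    (hgh : boxForm volume (fun z => g z - h z) ≤ r ^ 4) {S T : Set I} (hS : MeasurableSet S)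
    (hT : MeasurableSet T) : |∫ z in S ×ˢ T, (f z - g z)| ≤ 2 * r := by
  have i1 : ∀ u : I × I → ℝ, Measurable u → (∀ z, u z ∈ Set.Icc (0 : ℝ) 1) →
      IntegrableOn (fun z => u z - h z) (S ×ˢ T) volume := fun u hu hu1 =>
    (integrable_of_abs_le (hu.sub hh) 1 fun z =>
      abs_sub_le_one_of_mem_Icc (hu1 z) (hh1 z)).integrableOn
  have h1 : ∀ u : I × I → ℝ, Measurable u → (∀ z, u z ∈ Set.Icc (0 : ℝ) 1) →
      boxForm volume (fun z => u z - h z) ≤ r ^ 4 → |∫ z in S ×ˢ T, (u z - h z)| ≤ r :=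
    fun u hu hu1 hur => le_of_pow_le_pow_left₀ (n := 4) (by norm_num) hr
      ((abs_setIntegral_pow_four_le volume (hu.sub hh)
        (fun z => abs_sub_le_one_of_mem_Icc (hu1 z) (hh1 z)) hS hT).trans hur)
  have e : ∫ z in S ×ˢ T, (f z - g z)
      = (∫ z in S ×ˢ T, (f z - h z)) - ∫ z in S ×ˢ T, (g z - h z) := by
    rw [← integral_sub (i1 f hf hf1) (i1 g hg hg1)]
    simp
  rw [e]
  refine (abs_sub _ _).trans ?_
  linarith [h1 f hf hf1 hfh, h1 g hg hg1 hgh]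

/-- Align the optimal arrangements π for U and ρ for W, so that U and W^φ are both compared with one
step kernel; each of the k colours then costs 2r. -/
theorem exists_cutDist_pullback_le {U W : KGraphon k} {c : EdgeIndex n → Fin k} {r : ℝ}
    (hr : 0 ≤ r) (hU : U.minDiscrepancy c ≤ r ^ 4) (hW : W.minDiscrepancy c ≤ r ^ 4) :
    ∃ (φ : I → I) (hφ : MeasurePreserving φ volume volume),
      cutDist U (W.pullback φ hφ) ≤ k * (2 * r) := by
  obtain ⟨π, -, hπ⟩ := Finset.exists_mem_eq_inf' (s := Finset.univ) Finset.univ_nonempty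
    (U.discrepancy c)
  obtain ⟨ρ, -, hρ⟩ := Finset.exists_mem_eq_inf' (s := Finset.univ) Finset.univ_nonempty
    (W.discrepancy c)
  -- φ acts on cells by ρ⁻¹π, so the ρ-arranged kernel pulled back along φ is the π-arranged one.
  obtain ⟨φ, hφ, hφc⟩ := exists_measurePreserving_cell_comp (π.trans ρ.symm)
  set Wφ : KGraphon k := W.pullback φ hφ
  refine ⟨φ, hφ, Real.sSup_le ?_ (by positivity)⟩
  rintro _ ⟨S, T, hS, hT, rfl⟩
  have hle : ∀ (V : KGraphon k) (τ : Equiv.Perm (Fin n)), V.discrepancy c τ ≤ r ^ 4 → ∀ i,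
      boxForm volume (fun z => V.color i z - colouringKernel c τ i z) ≤ r ^ 4 := fun V τ h i =>
    (Finset.single_le_sum (f := fun i => boxForm volume fun z =>
      V.color i z - colouringKernel c τ i z) (fun _ _ => boxForm_nonneg _ _)
      (Finset.mem_univ i)).trans h
  have h1 := hle U π (hπ ▸ hU)
  have h2 := hle W ρ (hρ ▸ hW)
  have h3 : ∀ i, boxForm volume (fun z => Wφ.color i z - colouringKernel c π i z)
      ≤ r ^ 4 := fun i => by
    have e : (fun z => Wφ.color i z - colouringKernel c π i z)
        = (fun z => W.color i z - colouringKernel c ρ i z) ∘ Prod.map φ φ := by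
      funext z
      simp only [Function.comp_apply, colouringKernel, Prod.map_fst, Prod.map_snd, hφc,
        Equiv.trans_apply, Equiv.apply_symm_apply]
      rfl
    have hm : Measurable fun z => W.color i z - colouringKernel c ρ i z :=
      (W.measurable_color i).sub (measurable_colouringKernel c ρ i)
    rw [e, boxForm_comp hφ hm]
    exact h2 i
  refine (Finset.sum_le_sum fun i _ => abs_setIntegral_sub_le (U.measurable_color i)
    (Wφ.measurable_color i) (measurable_colouringKernel c π i)
    (U.color_mem_Icc i) (Wφ.color_mem_Icc i)
    (fun z => colourMatrix_mem_Icc _ _ _) hr (h1 i) (h3 i) hS hT).trans (le_of_eq ?_)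
  simp

end KGraphon

end

/-! ### A colouring close to both k-graphons -/

theorem mainTheorem10 (k : ℕ) (U W : KGraphon k) (hUW : U.Equivalent W) :
    KGraphon.cutDistance U W = 0 := by
  have hnn : ∀ V V' : KGraphon k, 0 ≤ KGraphon.cutDist V V' := fun V V' =>
    Real.sSup_nonneg (by rintro _ ⟨S, T, -, -, rfl⟩; exact Finset.sum_nonneg fun _ _ => abs_nonneg _)
  refine le_antisymm (le_of_forall_pos_le_add fun ε hε => ?_)
    (Real.sInf_nonneg (by rintro _ ⟨φ, hφ, rfl⟩; exact hnn _ _))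
  -- This makes the final bound 2kr at most ε; the two mean discrepancies get r⁴/2 each.
  set r : ℝ := ε / (2 * (k + 1)) with hr'
  have hr : 0 < r := by positivity
  have hη : 0 < r ^ 4 / 2 := by positivity
  obtain ⟨n, hn, hnU, hnW⟩ := ((Filter.eventually_gt_atTop 0).and
    ((U.eventually_sum_homDensity_mul_minDiscrepancy_le hη).and
      (W.eventually_sum_homDensity_mul_minDiscrepancy_le hη))).exists
  have : NeZero n := ⟨hn.ne'⟩
  -- First-moment argument: under the common law the mean of the sum is at most r⁴, so some
  -- colouring does not exceed it.
  obtain ⟨c, hc⟩ : ∃ c : EdgeIndex n → Fin k, U.minDiscrepancy c + W.minDiscrepancy c ≤ r ^ 4 := by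
    by_contra! hcon
    have h1 := U.sum_homDensity_colouringGraph (n := n)
    have h2 : ∑ c : EdgeIndex n → Fin k, DecoratedGraphon.homDensity (KGraphon.colouringGraph c) U
        * (U.minDiscrepancy c + W.minDiscrepancy c) ≤ r ^ 4 := by
      simp_rw [mul_add]
      rw [Finset.sum_add_distrib]
      have hW' : ∑ c : EdgeIndex n → Fin k, DecoratedGraphon.homDensity (KGraphon.colouringGraph c) U
          * W.minDiscrepancy c ≤ r ^ 4 / 2 := by
        -- Equivalence enters here: the weights from U become those from W.
        simp_rw [hUW n]
        exact hnW
      linarith [@hnU this]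
    -- A colouring of positive weight is needed for the weighted sum to exceed r⁴ strictly.
    have h3 : ∃ c : EdgeIndex n → Fin k,
        0 < DecoratedGraphon.homDensity (KGraphon.colouringGraph c) U := by
      by_contra! h
      exact absurd (h1.symm.le.trans (Finset.sum_nonpos fun c _ => h c)) (by norm_num)
    obtain ⟨c, hc⟩ := h3
    refine absurd h2 (not_le.2 ?_)
    calc r ^ 4 = ∑ c : EdgeIndex n → Fin k,
          DecoratedGraphon.homDensity (KGraphon.colouringGraph c) U * r ^ 4 := by
          rw [← Finset.sum_mul, h1, one_mul]
      _ < _ := Finset.sum_lt_sum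
          (fun c _ => mul_le_mul_of_nonneg_left (hcon c).le (U.homDensity_colouringGraph_nonneg c))
          ⟨c, Finset.mem_univ c, mul_lt_mul_of_pos_left (hcon c) hc⟩
  obtain ⟨φ, hφ, h⟩ := KGraphon.exists_cutDist_pullback_le hr.le
    (show U.minDiscrepancy c ≤ r ^ 4 by linarith [W.minDiscrepancy_nonneg c])
    (show W.minDiscrepancy c ≤ r ^ 4 by linarith [U.minDiscrepancy_nonneg c])
  have hb : BddBelow {s : ℝ | ∃ (φ : I → I) (hφ : MeasurePreserving φ volume volume),
      s = KGraphon.cutDist U (W.pullback φ hφ)} :=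
    ⟨0, by rintro _ ⟨φ, hφ, rfl⟩; exact hnn _ _⟩
  refine (csInf_le hb ⟨φ, hφ, rfl⟩).trans (h.trans ?_)
  rw [zero_add, hr', mul_div_assoc', mul_div_assoc', div_le_iff₀ (by positivity)]
  nlinarith
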